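/- **Setting.** Let $n \ge 4$ be even. Honest agents $1,\dots,n$ form an undirected line ($i$ adjacent to $i+1$ for $1\le i<n$), and one malicious agent $n+1$ is adjacent to all of them; $N(i)$ is the set of neighbors of $i$. There are $K=n$ arms with deterministic rewards: every pull of arm $k$ gives $\mu_k$, where $$\mu_1=1,\qquad \mu_k=\frac{13}{15}+\sum_{h=1}^{n/2-k}2^{-2^{h+1}}\ \ (2\le k\le n/2),\qquad \mu_k=0\ \ (k>n/2).$$ **Algorithm.** Put $\alpha=4$, $\beta=\eta=2$, $A_j=\lceil j^\beta\rceil=j^2$ ($A_0=0$); phase $j\ge1$ consists of the times $A_{j-1}+1,\dots,A_j$. Each honest agent $i$ has a sticky set $\hat S^{(i)}$ of size one, two distinct initial non-sticky arms $U_1^{(i)},L_1^{(i)}\notin\hat S^{(i)}$, active sets $S_j^{(i)}=\hat S^{(i)}\cup\{U_j^{(i)},L_j^{(i)}\}$, and initially empty blocklists $P_j^{(i)}$. These are arbitrary except that all arms of $S_1^{(i)}$ have index $>n/2$ for every $i>n/2$ (which is possible only when $n\ge 6$). - At each time $t$ of phase $j$, agent $i$ pulls an arm $I_t^{(i)}$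 maximizing $\hat\mu^{(i)}_k(t-1)+\sqrt{\alpha\log t/T^{(i)}_k(t-1)}$ over $k\in S^{(i)}_j$, where $T^{(i)}_k(t-1)$ is the number of its pulls of $k$ up to time $t-1$ and $\hat\mu_k^{(i)}(t-1)$ their empirical mean (the index is $+\infty$ if $T_k^{(i)}(t-1)=0$). - At the end of phase $j$, agent $i$ lets $B_j^{(i)}$ be its most played active arm in phase $j$. If $j>1$ and $i$ contacted $H_{j-1}^{(i)}$ at the end of phase $j-1$ and received an arm $R_{j-1}^{(i)}\ne B_j^{(i)}$, it adds $H_{j-1}^{(i)}$ to its blocklists $P_{j'}^{(i)}$ for all $j\le j'\le\lceil j^\eta\rceil$. - Then, independently across agents given the past, $i$ contacts $H_j^{(i)}$ uniform on $N(i)\setminus P_j^{(i)}$ (nobody, keeping its active set, if this is empty) and receives a recommended arm $R_j^{(i)}$, which equals $B_j^{(h)}$ if $h=H_j^{(i)}$ is honest. If $R_j^{(i)}\notin S_j^{(i)}$, then $U_{j+1}^{(i)}$ is whichever of $U_j^{(i)},L_j^{(i)}$ was played more in phase $j$ and $L_{j+1}^{(i)}=R_j^{(i)}$; otherwise the active set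 is unchanged. All ties are broken by arbitrary deterministic rules, which for each kind of choice may depend on the agent, on the time or phase, and on the set of maximizers. **Malicious strategy.** Let $J_1=2^8$ and $J_{l+1}=(J_l+2)^2$. When contacted by $i$ at the end of phase $j$, the malicious agent recommends $1-l+n/2$ if $j=J_l$ and $i\in\{l+1+n/2,\,l+2+n/2\}$ for some $1\le l\le n/2-1$; otherwise it recommends the arm $R_j^{(i)}\in S_j^{(i)}$ that will be the most played arm $B_{j+1}^{(i)}$ of $i$ in phase $j+1$ when the active set is unchanged. **Theorem 1.** There is an absolute constant $C>0$ such that, for all $n$, initializations and tie-breaking rules as above and all integers $T\ge2$, the regret $R_T^{(n)}=\sum_{t=1}^T\mathbb E[\mu_1-\mu_{I_t^{(n)}}]$ of honest agent $n$ satisfies $$R_T^{(n)}\ \ge\ C\,\min\Big\{\log T+\exp(\exp(n/3)),\ \frac{T}{\log^7T}\Big\}.$$ -/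

import Mathlib

noncomputable section

namespace RobustBandit

/-- A deterministic tie-breaking rule for `argmax` over a finite set of arms: it selects an element
of every nonempty set (to be applied to the set of maximizers). -/
structure TieBreak (K : ℕ) where
  select : Finset (Fin K) → Fin K
  select_mem : ∀ s : Finset (Fin K), s.Nonempty → select s ∈ s

/-- `argmax_{k ∈ S} f k`, ties being broken by `tb`. -/
def argmaxOn {K : ℕ} {β : Type} [LinearOrder β] (tb : TieBreak K) (S : Finset (Fin K))
    (f : Fin K → β) : Fin K :=
  tb.select (S.filter fun k => ∀ k' ∈ S, f k' ≤ f k)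

/-- The data of a multi-agent bandit with deterministic rewards and of the honest algorithm.
Honest agents are `Fin n`, malicious agents are `Fin m`, arms are `Fin K` (all indexed from `0`). -/
structure Setup (n m K : ℕ) where
  /-- the communication graph -/
  G : SimpleGraph (Fin n ⊕ Fin m)
  /-- arm `k` has reward law `δ_{μ k}`: every pull of it yields the reward `μ k` -/
  μ : Fin K → ℝ
  /-- UCB parameter -/
  α : ℝ
  /-- phase parameter -/
  β : ℝ
  /-- blocking parameter -/
  η : ℝ
  /-- sticky sets -/
  sticky : Fin n → Finset (Fin K)
  /-- initial non-sticky arms -/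
  U₁ : Fin n → Fin K
  /-- initial non-sticky arms -/
  L₁ : Fin n → Fin K
  /-- tie-breaking for the UCB rule of an agent at a given time -/
  tieUCB : Fin n → ℕ → TieBreak K
  /-- tie-breaking for the most played active arm of an agent in a given phase -/
  tieBest : Fin n → ℕ → TieBreak K
  /-- tie-breaking for the better non-sticky arm of an agent in a given phase -/
  tieKeep : Fin n → ℕ → TieBreak K

/-- The information kept by one honest agent. -/
structure AgentState (n m K : ℕ) where
  /-- `pulls t` is the arm pulled at time `t ≥ 1`, for the times `t` already elapsed (the values at
  other times are placeholders that are overwritten before they are used) -/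
  pulls : ℕ → Fin K
  /-- current first non-sticky arm -/
  U : Fin K
  /-- current second non-sticky arm -/
  L : Fin K
  /-- `block j` is the blocklist for phase `j` -/
  block : ℕ → Finset (Fin n ⊕ Fin m)
  /-- who was contacted at the end of the previous phase and the arm that was recommended; `none` if
  there was no such contact -/
  lastRec : Option ((Fin n ⊕ Fin m) × Fin K)

/-- The joint state of all honest agents. -/
abbrev State (n m K : ℕ) : Type := Fin n → AgentState n m K

/-- We only deal with discrete laws of states. -/
instance instMeasurableSpaceState (n m K : ℕ) : MeasurableSpace (State n m K) := ⊤

/-- A strategy of the malicious agents: the arm recommended by a malicious agent at the end of a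
given phase, given the states of the honest agents at that time, to a given honest agent. -/
abbrev Strategy (n m K : ℕ) : Type := Fin m → ℕ → State n m K → Fin n → Fin K

/-- `T_k(t)`: number of pulls of `k` during times `1, …, t`. -/
def numPulls {K : ℕ} (I : ℕ → Fin K) (k : Fin K) (t : ℕ) : ℕ :=
  ((Finset.Icc 1 t).filter fun s => I s = k).card

namespace Setup

variable {n m K : ℕ} (E : Setup n m K)

/-- `A_j = ⌈j ^ β⌉` for `j ≥ 1`, and `A_0 = 0`: phase `j` consists of the times
`A_{j-1} + 1, …, A_j`. -/
def commTime (j : ℕ) : ℕ := if j = 0 then 0 else ⌈(j : ℝ) ^ E.β⌉₊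

/-- The empirical mean of the pulls of `k` during times `1, …, t`. -/
def empMean (I : ℕ → Fin K) (k : Fin K) (t : ℕ) : ℝ :=
  (∑ s ∈ (Finset.Icc 1 t).filter (fun s => I s = k), E.μ (I s)) / (numPulls I k t : ℝ)

/-- The UCB index of arm `k` at time `t`; it is infinite if `k` was never pulled before. -/
def ucbIndex (I : ℕ → Fin K) (t : ℕ) (k : Fin K) : EReal :=
  if numPulls I k (t - 1) = 0 then ⊤
  else ((E.empMean I k (t - 1)
      + Real.sqrt (E.α * Real.log (t : ℝ) / (numPulls I k (t - 1) : ℝ)) : ℝ) : EReal)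

/-- Starting from the record `I` of the pulls up to time `t₀`, agent `i` runs UCB over the active
set `S` for `d` further time steps. -/
def runUCB (i : Fin n) (S : Finset (Fin K)) (t₀ : ℕ) (I : ℕ → Fin K) : ℕ → (ℕ → Fin K)
  | 0 => I
  | d + 1 =>
    let I' := runUCB i S t₀ I d
    Function.update I' (t₀ + d + 1)
      (argmaxOn (E.tieUCB i (t₀ + d + 1)) S (E.ucbIndex I' (t₀ + d + 1)))

/-- The record of the pulls of agent `i` after phase `j ≥ 1`, when it enters phase `j` with the
record `I` and its active set in phase `j` is `S`. -/
def runPhase (i : Fin n) (j : ℕ) (S : Finset (Fin K)) (I : ℕ → Fin K) : ℕ → Fin K :=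
  E.runUCB i S (E.commTime (j - 1)) I (E.commTime j - E.commTime (j - 1))

/-- `T_k(A_j) - T_k(A_{j-1})`: number of pulls of arm `k` in phase `j`. -/
def phasePulls (j : ℕ) (I : ℕ → Fin K) (k : Fin K) : ℕ :=
  numPulls I k (E.commTime j) - numPulls I k (E.commTime (j - 1))

/-- The active set. -/
def active (i : Fin n) (a : AgentState n m K) : Finset (Fin K) := E.sticky i ∪ {a.U, a.L}

/-- `B_j`: the active arm that was played most in phase `j`. -/
def mostPlayed (i : Fin n) (j : ℕ) (S : Finset (Fin K)) (I : ℕ → Fin K) : Fin K :=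
  argmaxOn (E.tieBest i j) S (E.phasePulls j I)

/-- Agent `i` plays phase `j`. -/
def playPhase (j : ℕ) (i : Fin n) (a : AgentState n m K) : AgentState n m K :=
  { a with pulls := E.runPhase i j (E.active i a) a.pulls }

/-- Best arm estimate of agent `i` whose state after playing phase `j` is `a`. -/
def best (j : ℕ) (i : Fin n) (a : AgentState n m K) : Fin K :=
  E.mostPlayed i j (E.active i a) a.pulls

/-- The blocklist update at the end of phase `j` (after phase `j` was played): if `j > 1` and the
arm recommended at the end of phase `j - 1` is not the most played arm of phase `j`, then the
recommender is blocked for the phases `j, …, ⌈j ^ η⌉`. -/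
def updateBlock (j : ℕ) (i : Fin n) (a : AgentState n m K) : AgentState n m K :=
  { a with
    block := fun j' =>
      match a.lastRec with
      | none => a.block j'
      | some (h, r) =>
        if 1 < j ∧ E.best j i a ≠ r ∧ j ≤ j' ∧ j' ≤ ⌈(j : ℝ) ^ E.η⌉₊ then insert h (a.block j')
        else a.block j' }

open Classical in
/-- `N(i) \ P_j`: the non-blocked neighbors of `i` at the end of phase `j`. -/
def available (j : ℕ) (i : Fin n) (a : AgentState n m K) : Finset (Fin n ⊕ Fin m) :=
  Finset.univ.filter fun v => E.G.Adj (Sum.inl i) v ∧ v ∉ a.block j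

/-- The possible contacts of `i` at the end of phase `j`: a non-blocked neighbor, and nobody if all
neighbors are blocked. -/
def contacts (j : ℕ) (i : Fin n) (a : AgentState n m K) : Finset (Option (Fin n ⊕ Fin m)) :=
  if (E.available j i a).Nonempty then (E.available j i a).map Function.Embedding.some else {none}

theorem contacts_nonempty (j : ℕ) (i : Fin n) (a : AgentState n m K) :
    (E.contacts j i a).Nonempty := by
  unfold contacts
  split_ifs with h
  · exact h.map
  · exact Finset.singleton_nonempty _

/-- The active set update at the end of phase `j`, given the contacted neighbor and the arm that it
recommends (`none` if nobody is contacted; the active set is then kept). -/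
def receive (j : ℕ) (i : Fin n) (a : AgentState n m K)
    (rec : Option ((Fin n ⊕ Fin m) × Fin K)) : AgentState n m K :=
  match rec with
  | none => { a with lastRec := none }
  | some (h, r) =>
    if r ∈ E.active i a then { a with lastRec := some (h, r) }
    else
      { a with
        U := argmaxOn (E.tieKeep i j) {a.U, a.L} (E.phasePulls j a.pulls)
        L := r
        lastRec := some (h, r) }

/-- All agents play phase `j` and update their blocklists. -/
def play (j : ℕ) (s : State n m K) : State n m K :=
  fun i => E.updateBlock j i (E.playPhase j i (s i))

/-- The recommendation to agent `i` at the end of phase `j` from the contacted agent: honest agents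
recommend their most played arm of phase `j`, malicious ones follow `mal`. -/
def recommend (mal : Strategy n m K) (j : ℕ) (s : State n m K) (i : Fin n) :
    Fin n ⊕ Fin m → Fin K
  | Sum.inl i' => E.best j i' (s i')
  | Sum.inr q => mal q j s i

/-- All agents communicate at the end of phase `j` (after `play`), `c i` being the contact of
agent `i`. -/
def communicate (mal : Strategy n m K) (j : ℕ) (s : State n m K)
    (c : Fin n → Option (Fin n ⊕ Fin m)) : State n m K :=
  fun i => E.receive j i (s i) ((c i).map fun v => (v, E.recommend mal j s i v))

/-- One phase. Conditionally on the past, the contacts of the agents are independent, that of `i`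
being uniform on its non-blocked neighbors; in other words, the family of contacts is uniform on
the product of the sets of possible contacts. -/
def phaseStep (mal : Strategy n m K) (j : ℕ) (s : State n m K) : PMF (State n m K) :=
  (PMF.uniformOfFinset (Fintype.piFinset fun i => E.contacts j i (E.play j s i))
    (Fintype.piFinset_nonempty.2 fun i => E.contacts_nonempty j i (E.play j s i))).map
    (E.communicate mal j (E.play j s))

/-- The initial state. -/
def initState : State n m K := fun i =>
  { pulls := fun _ => E.U₁ i
    U := E.U₁ i
    L := E.L₁ i
    block := fun _ => ∅
    lastRec := none }

/-- The law of the state after `j` phases. -/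
def law (mal : Strategy n m K) : ℕ → PMF (State n m K)
  | 0 => PMF.pure E.initState
  | j + 1 => (law mal j).bind (E.phaseStep mal (j + 1))

/-- The regret `R_T^{(i)} = ∑_{t=1}^T 𝔼[μ_{k₁} - μ_{I_t^{(i)}}]` of agent `i` with respect to the
best arm `k₁`. (For `β ≥ 1` one has `A_T ≥ T`, so the pulls up to time `T` are read off from the
state after `T` phases.) -/
def regret (mal : Strategy n m K) (k₁ : Fin K) (i : Fin n) (T : ℕ) : ℝ :=
  ∑ t ∈ Finset.Icc 1 T, ∫ s, (E.μ k₁ - E.μ ((s i).pulls t)) ∂(E.law mal T).toMeasure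

end Setup

/-- The graph of the bad instance: the `n` honest agents form a line and the only malicious agent is
adjacent to all of them. -/
def badGraph (n : ℕ) : SimpleGraph (Fin n ⊕ Fin 1) :=
  SimpleGraph.fromRel fun v w =>
    match v, w with
    | Sum.inl a, Sum.inl b => a.val + 1 = b.val
    | Sum.inl _, Sum.inr _ => True
    | Sum.inr _, _ => False

/-- The mean of the arm with label `k ∈ {1, …, n}` in the bad instance. -/
def badMean (n k : ℕ) : ℝ :=
  if k = 1 then 1
  else if k ≤ n / 2 then 13 / 15 + ∑ h ∈ Finset.Icc 1 (n / 2 - k), ((2 : ℝ) ^ (2 ^ (h + 1)))⁻¹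
  else 0

/-- The bad instance with `α = 4`, `β = η = 2`. Element `i` of `Fin n` is the agent, or arm, with
label `i + 1`. -/
def badSetup (n : ℕ) (sticky : Fin n → Finset (Fin n)) (U₁ L₁ : Fin n → Fin n)
    (tieUCB tieBest tieKeep : Fin n → ℕ → TieBreak n) : Setup n 1 n where
  G := badGraph n
  μ := fun k => badMean n (k.val + 1)
  α := 4
  β := 2
  η := 2
  sticky := sticky
  U₁ := U₁
  L₁ := L₁
  tieUCB := tieUCB
  tieBest := tieBest
  tieKeep := tieKeep

/-- `J_1 = 2 ^ 8` and `J_{l+1} = (J_l + 2) ^ 2` for `l ≥ 1` (`J_0` is not used). -/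
def badPhase : ℕ → ℕ
  | 0 => 0
  | 1 => 2 ^ 8
  | l + 2 => (badPhase (l + 1) + 2) ^ 2

/-- Phase `j = J_l` with `1 ≤ l ≤ n / 2 - 1`, and `i` has label `l + 1 + n / 2` or
`l + 2 + n / 2`. -/
def IsAttack (n j : ℕ) (i : Fin n) (l : ℕ) : Prop :=
  1 ≤ l ∧ l + 1 ≤ n / 2 ∧ j = badPhase l ∧
    (i.val + 1 = l + 1 + n / 2 ∨ i.val + 1 = l + 2 + n / 2)

open Classical in
/-- The malicious strategy: in the attacks above, recommend the arm with label `1 - l + n / 2`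
(`l` is unique, as `badPhase` is strictly increasing); otherwise, recommend the active arm that `i`
is going to play most in phase `j + 1` if its active set does not change. -/
def badStrategy {n : ℕ} (E : Setup n 1 n) : Strategy n 1 n := fun _ j s i =>
  if h : ∃ l, IsAttack n j i l then ⟨n / 2 - Nat.find h, by have := i.isLt; omega⟩
  else
    E.mostPlayed i (j + 1) (E.active i (s i))
      (E.runPhase i (j + 1) (E.active i (s i)) (s i).pulls)

/-- The requirements on the sticky sets (of size one) and on the initial non-sticky arms; the right
half of the honest agents initially have only bad arms (label `> n / 2`) active. -/
def BadInit (n : ℕ) (sticky : Fin n → Finset (Fin n)) (U₁ L₁ : Fin n → Fin n) : Prop :=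
  (∀ i, (sticky i).card = 1 ∧ U₁ i ∉ sticky i ∧ L₁ i ∉ sticky i ∧ U₁ i ≠ L₁ i) ∧
    ∀ i : Fin n, n / 2 < i.val + 1 → ∀ k ∈ sticky i ∪ {U₁ i, L₁ i}, n / 2 < k.val + 1

end RobustBandit

end

/-! Agents and arms are counted from 0. Write N = n/2 and J_l = `badPhase l`. A frontier moves right
along the line. From phase J_l until just before J_{l+1}, the front is agent N + l, and from the
front on nobody has an arm better than N - l (`StageInv`). The last agent is beyond every front with
l < N, so until then it never pulls arm 0 and pays at least 1/15 per step.

The frontier survives because the front blocks its left neighbor, its only honest source of better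
arms. At the end of phase J_l the malicious agent gives arm N - l to the front and to the agent on
its right. If the front contacts its left neighbor one phase later, it receives a worse arm. In
phase J_l + 2 it plays arm N - l most (`phasePulls_lt`: the phase is long enough to detect the gap),
so it blocks that neighbor up to phase (J_l + 2)^2 = J_{l+1}, when the next attack occurs. The
second target must also own arm N - l: recommendations of this arm by the front then give it no
reason to block the front, which it has to contact in the next stage. The malicious agent is never
blocked by these agents, since its recommendations are always the arm played most afterwards
(`best_of_contact_malicious`, `best_eq`). `StageInv.succ` and `StageInv.succ_stage` propagate this
picture.

Every agent has at most three possible contacts, so prescribing one costs a factor 3 in probability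
(`law_mul_le_law_succ`). Three contacts in each of the first 256 phases, and three per later stage,
suffice: stage l is reached as planned with probability at least 3^-(768 + 3l)
(`le_law_attackEvent`). Hence the regret is of order T / 27^l while T is in stage l. As J_l grows
doubly exponentially, 2^l is O(log T), and 27 ≤ 2^7 gives T / log^7 T (`div_log_pow_le_regret`).
Once T > J_N^2, the regret collected by time J_N^2 already exceeds a multiple of exp(exp(n/3)), and
the useless sticky arm contributes log T (`log_add_exp_le_regret`). -/

namespace RobustBandit

/-! ### Counting pulls; maximizers with tie-breaking -/

section Pulls

variable {K : ℕ}

theorem numPulls_succ (I : ℕ → Fin K) (k : Fin K) (t : ℕ) :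
    numPulls I k (t + 1) = numPulls I k t + if I (t + 1) = k then 1 else 0 := by
  unfold numPulls
  rw [← Finset.insert_Icc_right_eq_Icc_add_one (by omega), Finset.filter_insert]
  split_ifs with h
  · rw [Finset.card_insert_of_notMem (by simp)]
  · simp

theorem numPulls_mono (I : ℕ → Fin K) (k : Fin K) : Monotone (numPulls I k) :=
  monotone_nat_of_le_succ fun t => by rw [numPulls_succ]; omega

theorem numPulls_congr {I I' : ℕ → Fin K} {t : ℕ} (h : ∀ s, s ≤ t → I s = I' s) (k : Fin K) :
    numPulls I k t = numPulls I' k t := by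
  unfold numPulls
  congr 1
  refine Finset.filter_congr fun s hs => ?_
  rw [h s (Finset.mem_Icc.1 hs).2]

/-- If `k` is only pulled while it has been pulled at most `B` times, then it is pulled at most
`B + 1` times. -/
theorem numPulls_sub_le {I : ℕ → Fin K} {k : Fin K} {a : ℕ} {B : ℝ} (hB : 0 ≤ B) {b : ℕ}
    (hab : a ≤ b)
    (h : ∀ u, a < u → u ≤ b → I u = k → (numPulls I k (u - 1) : ℝ) ≤ B) :
    ((numPulls I k b - numPulls I k a : ℕ) : ℝ) ≤ B + 1 := by
  induction b, hab using Nat.le_induction with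
  | base => simp; linarith
  | succ b hab ih =>
    by_cases hk : I (b + 1) = k
    · have h1 := h (b + 1) (by omega) le_rfl hk
      have h2 : numPulls I k (b + 1) - numPulls I k a ≤ numPulls I k b + 1 := by
        rw [numPulls_succ, if_pos hk]; omega
      have h3 : ((numPulls I k (b + 1) - numPulls I k a : ℕ) : ℝ) ≤ (numPulls I k b : ℝ) + 1 := by
        exact_mod_cast h2
      simp only [Nat.add_sub_cancel] at h1
      linarith
    · rw [numPulls_succ, if_neg hk, add_zero]
      exact ih fun u hu hub => h u hu (by omega)

theorem sum_numPulls {I : ℕ → Fin K} {S : Finset (Fin K)} {a b : ℕ} (hab : a ≤ b)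
    (h : ∀ u, a < u → u ≤ b → I u ∈ S) :
    ∑ k ∈ S, (numPulls I k b - numPulls I k a) = b - a := by
  induction b, hab using Nat.le_induction with
  | base => simp
  | succ b hab ih =>
    have key : ∀ k ∈ S, numPulls I k (b + 1) - numPulls I k a =
        (numPulls I k b - numPulls I k a) + if I (b + 1) = k then 1 else 0 := fun k _ => by
      have := numPulls_mono I k hab
      rw [numPulls_succ]; omega
    rw [Finset.sum_congr rfl key, Finset.sum_add_distrib, ih fun u hu hub => h u hu (by omega),
      Finset.sum_ite_eq, if_pos (h _ (by omega) le_rfl)]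
    omega

end Pulls

section Argmax

variable {K : ℕ} {β : Type} [LinearOrder β] (tb : TieBreak K) {S : Finset (Fin K)} (f : Fin K → β)

theorem argmaxOn_mem_filter (hS : S.Nonempty) :
    argmaxOn tb S f ∈ S.filter fun k => ∀ k' ∈ S, f k' ≤ f k := by
  obtain ⟨k, hk, hmax⟩ := Finset.exists_max_image S f hS
  exact tb.select_mem _ ⟨k, Finset.mem_filter.2 ⟨hk, hmax⟩⟩

theorem argmaxOn_mem (hS : S.Nonempty) : argmaxOn tb S f ∈ S :=
  (Finset.mem_filter.1 (argmaxOn_mem_filter tb f hS)).1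

theorem le_argmaxOn {k : Fin K} (hk : k ∈ S) : f k ≤ f (argmaxOn tb S f) :=
  (Finset.mem_filter.1 (argmaxOn_mem_filter tb f ⟨k, hk⟩)).2 k hk

theorem argmaxOn_eq {m : Fin K} (hm : m ∈ S) (h : ∀ k ∈ S, k ≠ m → f k < f m) :
    argmaxOn tb S f = m := by
  by_contra hne
  exact absurd (le_argmaxOn tb f hm) (not_le.2 (h _ (argmaxOn_mem tb f ⟨m, hm⟩) hne))

end Argmax

/-! ### UCB with deterministic rewards -/

namespace Setup

variable {n m K : ℕ} (E : Setup n m K)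

theorem empMean_eq {I : ℕ → Fin K} {k : Fin K} {t : ℕ} (h : numPulls I k t ≠ 0) :
    E.empMean I k t = E.μ k := by
  unfold empMean
  rw [Finset.sum_congr rfl fun s hs => by rw [(Finset.mem_filter.1 hs).2], Finset.sum_const,
    nsmul_eq_mul]
  exact mul_div_cancel_left₀ _ (by exact_mod_cast h)

theorem ucbIndex_eq {I : ℕ → Fin K} {k : Fin K} {t : ℕ} (h : numPulls I k (t - 1) ≠ 0) :
    E.ucbIndex I t k =
      ((E.μ k + Real.sqrt (E.α * Real.log t / (numPulls I k (t - 1) : ℝ)) : ℝ) : EReal) := by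
  rw [ucbIndex, if_neg h, E.empMean_eq h]

theorem ucbIndex_congr {I I' : ℕ → Fin K} {t : ℕ} (h : ∀ s, s ≤ t - 1 → I s = I' s) :
    E.ucbIndex I t = E.ucbIndex I' t := by
  funext k
  have hk := numPulls_congr h k
  by_cases h0 : numPulls I k (t - 1) = 0
  · rw [ucbIndex, ucbIndex, if_pos h0, if_pos (hk ▸ h0)]
  · rw [E.ucbIndex_eq h0, E.ucbIndex_eq (hk ▸ h0), hk]

/-- The pull at time `u` maximizes the UCB index over `S`. -/
def IsUCBPull (S : Finset (Fin K)) (I : ℕ → Fin K) (u : ℕ) : Prop :=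
  I u ∈ S ∧ ∀ k ∈ S, E.ucbIndex I u k ≤ E.ucbIndex I u (I u)

variable {E} in
theorem IsUCBPull.congr {S : Finset (Fin K)} {I I' : ℕ → Fin K} {u : ℕ} (h : E.IsUCBPull S I u)
    (hI : ∀ s, s ≤ u → I s = I' s) : E.IsUCBPull S I' u := by
  have := E.ucbIndex_congr (t := u) fun s hs => hI s (by omega)
  rw [IsUCBPull, ← this, ← hI u le_rfl]
  exact h

theorem runUCB_of_le (i : Fin n) (S : Finset (Fin K)) (t₀ : ℕ) (I : ℕ → Fin K) (d : ℕ) {u : ℕ}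
    (hu : u ≤ t₀) : E.runUCB i S t₀ I d u = I u := by
  induction d with
  | zero => rfl
  | succ d ih => rw [runUCB, Function.update_of_ne (by omega), ih]

theorem isUCBPull_runUCB (i : Fin n) {S : Finset (Fin K)} (hS : S.Nonempty) (t₀ : ℕ)
    (I : ℕ → Fin K) (d : ℕ) {u : ℕ} (hu : t₀ < u) (hud : u ≤ t₀ + d) :
    E.IsUCBPull S (E.runUCB i S t₀ I d) u := by
  induction d with
  | zero => omega
  | succ d ih =>
    rcases Nat.lt_or_ge (t₀ + d) u with h | h
    · obtain rfl : u = t₀ + d + 1 := by omega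
      have hc : E.ucbIndex (E.runUCB i S t₀ I (d + 1)) (t₀ + d + 1) =
          E.ucbIndex (E.runUCB i S t₀ I d) (t₀ + d + 1) :=
        E.ucbIndex_congr fun s hs => by rw [runUCB, Function.update_of_ne (by omega)]
      have hv : E.runUCB i S t₀ I (d + 1) (t₀ + d + 1) =
          argmaxOn (E.tieUCB i (t₀ + d + 1)) S
            (E.ucbIndex (E.runUCB i S t₀ I d) (t₀ + d + 1)) := by
        rw [runUCB, Function.update_self]
      rw [IsUCBPull, hc, hv]
      exact ⟨argmaxOn_mem _ _ hS, fun k hk => le_argmaxOn _ _ hk⟩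
    · exact (ih h).congr fun s hs => by rw [runUCB, Function.update_of_ne (by omega)]

/-- An arm that is worse than another active arm is pulled only logarithmically often by UCB. -/
theorem numPulls_sub_le_of_isUCBPull {S : Finset (Fin K)} {I : ℕ → Fin K} {a b : ℕ} (hab : a ≤ b)
    (hI : ∀ u, a < u → u ≤ b → E.IsUCBPull S I u) (hα : 0 ≤ E.α) {k k' : Fin K} (hk' : k' ∈ S)
    (hlt : E.μ k < E.μ k') {D : ℝ} (hD : 1 ≤ D * (E.μ k' - E.μ k) ^ 2) :
    ((numPulls I k b - numPulls I k a : ℕ) : ℝ) ≤ D * (E.α * Real.log b) + 1 := by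
  have hgap : 0 < E.μ k' - E.μ k := sub_pos.2 hlt
  have hD0 : 0 < D := by
    by_contra h
    nlinarith [sq_nonneg (E.μ k' - E.μ k)]
  have hB : 0 ≤ D * (E.α * Real.log b) :=
    mul_nonneg hD0.le (mul_nonneg hα (Real.log_natCast_nonneg _))
  refine numPulls_sub_le hB hab fun u hu hub hk => ?_
  by_cases h0 : numPulls I k (u - 1) = 0
  · simpa [h0] using hB
  have h1 := (hI u hu hub).2 k' hk'
  rw [hk, E.ucbIndex_eq h0] at h1
  by_cases h0' : numPulls I k' (u - 1) = 0
  · rw [ucbIndex, if_pos h0'] at h1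
    exact absurd (top_le_iff.1 h1) (EReal.coe_ne_top _)
  rw [E.ucbIndex_eq h0', EReal.coe_le_coe_iff] at h1
  have hT : (0 : ℝ) < numPulls I k (u - 1) := by exact_mod_cast Nat.pos_of_ne_zero h0
  -- The bonus of `k'` is nonnegative, so the bonus of `k` alone must cover the gap.
  have h2 : E.μ k' - E.μ k ≤ Real.sqrt (E.α * Real.log u / (numPulls I k (u - 1) : ℝ)) := by
    linarith [Real.sqrt_nonneg (E.α * Real.log u / (numPulls I k' (u - 1) : ℝ))]
  have h3 := (Real.le_sqrt' hgap).1 h2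
  rw [le_div_iff₀ hT] at h3
  have hu0 : (0 : ℝ) < u := by exact_mod_cast (by omega : 0 < u)
  have h4 : Real.log u ≤ Real.log b := Real.log_le_log hu0 (by exact_mod_cast hub)
  have h5 : E.α * Real.log u ≤ E.α * Real.log b := mul_le_mul_of_nonneg_left h4 hα
  calc (numPulls I k (u - 1) : ℝ) ≤ (D * (E.μ k' - E.μ k) ^ 2) * numPulls I k (u - 1) :=
        le_mul_of_one_le_left hT.le hD
    _ = D * ((E.μ k' - E.μ k) ^ 2 * numPulls I k (u - 1)) := by ring
    _ ≤ D * (E.α * Real.log b) := mul_le_mul_of_nonneg_left (h3.trans h5) hD0.le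

/-- An active arm of nonnegative mean is pulled at least logarithmically often by UCB, if the
means are at most one and there are few arms. -/
theorem log_le_numPulls {I : ℕ → Fin K} {T : ℕ} {k : Fin K}
    (hI : ∀ u, 0 < u → u ≤ T → ∃ S, k ∈ S ∧ E.IsUCBPull S I u) (hα : E.α = 4)
    (hμ : ∀ k', E.μ k' ≤ 1) (hk : 0 ≤ E.μ k) {M : ℕ} (hM : T ≤ M ^ 2) (hMT : M ≤ T) (hM0 : 1 < M)
    (hT : K * (Real.log T + 1) < (T - M : ℝ)) :
    2 / 9 * Real.log T ≤ numPulls I k T := by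
  by_contra hcon
  push Not at hcon
  have hlogT : 0 ≤ Real.log T := Real.log_natCast_nonneg _
  -- After time `M ≥ √T` the few pulls of `k` force its bonus to be at least 3. Any arm pulled
  -- instead has mean at most 1, hence a bonus of at least 2, hence at most `log T` earlier pulls.
  -- So `K` arms cannot fill the times from `M` to `T`.
  have key : ∀ k' : Fin K, ((numPulls I k' T - numPulls I k' M : ℕ) : ℝ) ≤ Real.log T + 1 := by
    intro k'
    refine numPulls_sub_le hlogT hMT fun u hu huT hk' => ?_
    by_cases h0' : numPulls I k' (u - 1) = 0
    · simpa [h0'] using hlogT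
    obtain ⟨S, hkS, hS⟩ := hI u (by omega) huT
    have h1 := hS.2 k hkS
    rw [hk', E.ucbIndex_eq h0'] at h1
    by_cases h0 : numPulls I k (u - 1) = 0
    · rw [ucbIndex, if_pos h0] at h1
      exact absurd (top_le_iff.1 h1) (EReal.coe_ne_top _)
    rw [E.ucbIndex_eq h0, EReal.coe_le_coe_iff, hα] at h1
    have hp : (0 : ℝ) < numPulls I k (u - 1) := by exact_mod_cast Nat.pos_of_ne_zero h0
    have hp' : (0 : ℝ) < numPulls I k' (u - 1) := by exact_mod_cast Nat.pos_of_ne_zero h0'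
    have hle : (numPulls I k (u - 1) : ℝ) ≤ numPulls I k T := by
      exact_mod_cast numPulls_mono I k (by omega)
    have hMu : (M : ℝ) ≤ u := by exact_mod_cast hu.le
    have hMpos : (0 : ℝ) < M := by exact_mod_cast (by omega : 0 < M)
    have hupos : (0 : ℝ) < u := hMpos.trans_le hMu
    have hTpos : (0 : ℝ) < T := hMpos.trans_le (by exact_mod_cast hMT)
    have hl1 : Real.log T ≤ 2 * Real.log u := by
      have : Real.log T ≤ Real.log ((M : ℝ) ^ 2) :=
        Real.log_le_log hTpos (by exact_mod_cast hM)
      rw [Real.log_pow] at this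
      have := Real.log_le_log hMpos hMu
      push_cast at *
      linarith
    have hl2 : Real.log u ≤ Real.log T := Real.log_le_log hupos (by exact_mod_cast huT)
    have h3 : 3 ≤ Real.sqrt (4 * Real.log u / (numPulls I k (u - 1) : ℝ)) := by
      apply Real.le_sqrt_of_sq_le
      rw [le_div_iff₀ hp]
      linarith
    have h4 : 2 ≤ Real.sqrt (4 * Real.log u / (numPulls I k' (u - 1) : ℝ)) := by
      linarith [hμ k']
    have h5 := (Real.le_sqrt' (by norm_num)).1 h4
    rw [le_div_iff₀ hp'] at h5
    linarith
  have hsum := sum_numPulls (I := I) (S := Finset.univ) hMT fun u _ _ => Finset.mem_univ _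
  have hsum' : ((T - M : ℕ) : ℝ) ≤ K * (Real.log T + 1) := by
    rw [← hsum, Nat.cast_sum]
    refine (Finset.sum_le_sum fun k' _ => key k').trans ?_
    simp [mul_add]
  rw [Nat.cast_sub hMT] at hsum'
  linarith

end Setup

/-! ### Probability cost of prescribing contacts -/

open scoped ENNReal

/-- Replacing the factors indexed by `F` with singletons shrinks the product set by at most `d` per
factor. The event also records membership in `t`, so that the feasibility of all contacts remains
available afterwards. -/
theorem forced_le_uniformOfFinset_piFinset {ι α : Type} [Fintype ι] [DecidableEq ι]
    (t : ι → Finset α) (ht : (Fintype.piFinset t).Nonempty) (F : Finset ι) (r : ι → α) {d : ℕ}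
    (hd : ∀ i ∈ F, (t i).card ≤ d) (hr : ∀ i ∈ F, r i ∈ t i) :
    ((d : ℝ≥0∞) ^ F.card)⁻¹ ≤ (PMF.uniformOfFinset (Fintype.piFinset t) ht).toOuterMeasure
      {c | (∀ i, c i ∈ t i) ∧ ∀ i ∈ F, c i = r i} := by
  classical
  rw [PMF.toOuterMeasure_uniformOfFinset_apply]
  set t' : ι → Finset α := fun i => if i ∈ F then {r i} else t i with ht'
  have hsub : Fintype.piFinset t' ⊆ (Fintype.piFinset t).filter
      (· ∈ {c : ι → α | (∀ i, c i ∈ t i) ∧ ∀ i ∈ F, c i = r i}) := by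
    intro c hc
    rw [Fintype.mem_piFinset] at hc
    have h1 : ∀ i ∈ F, c i = r i := fun i hi => by
      have := hc i
      simpa only [ht', if_pos hi, Finset.mem_singleton] using this
    have h2 : ∀ i, c i ∈ t i := fun i => by
      by_cases hi : i ∈ F
      · rw [h1 i hi]; exact hr i hi
      · have := hc i
        simpa only [ht', if_neg hi] using this
    exact Finset.mem_filter.2 ⟨Fintype.mem_piFinset.2 h2, h2, h1⟩
  have hcard : (Fintype.piFinset t).card ≤ d ^ F.card * (Fintype.piFinset t').card := by
    rw [Fintype.card_piFinset, Fintype.card_piFinset]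
    calc ∏ i, (t i).card ≤ ∏ i, (if i ∈ F then d else 1) * (t' i).card := by
          refine Finset.prod_le_prod' fun i _ => ?_
          by_cases hi : i ∈ F
          · simpa [ht', hi] using hd i hi
          · simp [ht', hi]
      _ = d ^ F.card * ∏ i, (t' i).card := by
          rw [Finset.prod_mul_distrib]
          congr 1
          simp
  have hle := hcard.trans (Nat.mul_le_mul_left (d ^ F.card) (Finset.card_le_card hsub))
  have hpos : (Fintype.piFinset t).card ≠ 0 := ht.card_pos.ne'
  have hd0 : d ^ F.card ≠ 0 := by
    intro h
    rw [h, zero_mul] at hle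
    omega
  rw [ENNReal.le_div_iff_mul_le (Or.inl (by exact_mod_cast hpos))
    (Or.inl (ENNReal.natCast_ne_top _)), mul_comm, ← div_eq_mul_inv]
  refine ENNReal.div_le_of_le_mul ?_
  rw [mul_comm]
  refine (Nat.cast_le.2 hle).trans (le_of_eq ?_)
  rw [Nat.cast_mul, Nat.cast_pow]
  congr!

namespace Setup

variable {n m K : ℕ} (E : Setup n m K)

/-- If, from `G`, the contacts of the agents in `F` being as prescribed leads to `G'`, then the
probability of `G'` is at least that of `G` up to a factor for each prescribed contact. -/
theorem law_mul_le_law_succ (mal : Strategy n m K) (j : ℕ) {G G' : Set (State n m K)}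
    (F : Finset (Fin n)) (r : Fin n → Fin n ⊕ Fin m) {d : ℕ}
    (hd : ∀ s ∈ G, ∀ i ∈ F, (E.contacts (j + 1) i (E.play (j + 1) s i)).card ≤ d)
    (hr : ∀ s ∈ G, ∀ i ∈ F, some (r i) ∈ E.contacts (j + 1) i (E.play (j + 1) s i))
    (h : ∀ s ∈ G, ∀ c : Fin n → Option (Fin n ⊕ Fin m),
      (∀ i, c i ∈ E.contacts (j + 1) i (E.play (j + 1) s i)) → (∀ i ∈ F, c i = some (r i)) →
      E.communicate mal (j + 1) (E.play (j + 1) s) c ∈ G') :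
    (E.law mal j).toOuterMeasure G * ((d : ℝ≥0∞) ^ F.card)⁻¹ ≤
      (E.law mal (j + 1)).toOuterMeasure G' := by
  rw [law, PMF.toOuterMeasure_bind_apply, PMF.toOuterMeasure_apply, ← ENNReal.tsum_mul_right]
  refine ENNReal.tsum_le_tsum fun s => ?_
  by_cases hs : s ∈ G
  · rw [Set.indicator_of_mem hs]
    gcongr
    rw [phaseStep, PMF.toOuterMeasure_map_apply]
    refine (forced_le_uniformOfFinset_piFinset _ _ F (fun i => some (r i)) (hd s hs)
      (hr s hs)).trans (MeasureTheory.OuterMeasure.mono _ fun c hc => ?_)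
    exact h s hs c hc.1 hc.2
  · rw [Set.indicator_of_notMem hs, zero_mul]
    exact zero_le

theorem law_le_law_of_invariant (mal : Strategy n m K) {G : ℕ → Set (State n m K)} {j j' : ℕ}
    (hj : j ≤ j')
    (h : ∀ u, j ≤ u → u < j' → ∀ s ∈ G u, ∀ c : Fin n → Option (Fin n ⊕ Fin m),
      (∀ i, c i ∈ E.contacts (u + 1) i (E.play (u + 1) s i)) →
      E.communicate mal (u + 1) (E.play (u + 1) s) c ∈ G (u + 1)) :
    (E.law mal j).toOuterMeasure (G j) ≤ (E.law mal j').toOuterMeasure (G j') := by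
  induction j', hj using Nat.le_induction with
  | base => exact le_rfl
  | succ u hu ih =>
    refine (ih fun v hv hvu => h v hv (by omega)).trans ?_
    -- Nothing is prescribed, so the cost is `d ^ 0 = 1` whatever `d` is.
    have := E.law_mul_le_law_succ mal u (G := G u) (G' := G (u + 1)) ∅ (fun i => Sum.inl i)
      (d := 0) (by simp) (by simp) fun s hs c hc _ => h u hu (by omega) s hs c hc
    simpa using this

/-- The regret is at least `x` times the probability that the agent accumulates `x`. -/
theorem mul_law_le_regret (mal : Strategy n m K) {k₁ : Fin K} (hk₁ : ∀ k, E.μ k ≤ E.μ k₁)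
    (i : Fin n) (T : ℕ) {x : ℝ} (G : Set (State n m K))
    (hG : ∀ s ∈ G, x ≤ ∑ t ∈ Finset.Icc 1 T, (E.μ k₁ - E.μ ((s i).pulls t))) :
    x * ((E.law mal T).toOuterMeasure G).toReal ≤ E.regret mal k₁ i T := by
  have hmeas : ∀ f : State n m K → ℝ, Measurable f := fun f _ _ => trivial
  have hint : ∀ t ∈ Finset.Icc 1 T, MeasureTheory.Integrable
      (fun s : State n m K => E.μ k₁ - E.μ ((s i).pulls t)) (E.law mal T).toMeasure := by
    intro t _
    obtain ⟨B, hB⟩ := (Set.finite_range fun k => ‖E.μ k₁ - E.μ k‖).bddAbove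
    exact MeasureTheory.Integrable.of_bound (hmeas _).aestronglyMeasurable B
      (Filter.Eventually.of_forall fun s => hB ⟨(s i).pulls t, rfl⟩)
  rw [regret, ← MeasureTheory.integral_finsetSum _ hint]
  have hmG : MeasurableSet G := trivial
  have h1 : x * ((E.law mal T).toOuterMeasure G).toReal =
      ∫ s, G.indicator (fun _ => x) s ∂(E.law mal T).toMeasure := by
    rw [MeasureTheory.integral_indicator hmG, MeasureTheory.setIntegral_const,
      MeasureTheory.measureReal_def, PMF.toMeasure_apply_eq_toOuterMeasure_apply _ hmG,
      smul_eq_mul, mul_comm]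
  rw [h1]
  refine MeasureTheory.integral_mono ?_ (MeasureTheory.integrable_finsetSum _ hint) fun s => ?_
  · exact (MeasureTheory.integrable_const x).indicator hmG
  · by_cases hs : s ∈ G
    · rw [Set.indicator_of_mem hs]; exact hG s hs
    · rw [Set.indicator_of_notMem hs]
      exact Finset.sum_nonneg fun t _ => sub_nonneg.2 (hk₁ _)

/-! ### Effect of one phase on blocklists and active sets -/

theorem commTime_eq (hβ : E.β = 2) (j : ℕ) : E.commTime j = j ^ 2 := by
  unfold commTime
  split_ifs with h
  · simp [h]
  · rw [hβ, Real.rpow_ofNat]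
    exact_mod_cast Nat.ceil_natCast (R := ℝ) (j ^ 2)

theorem mem_block_play (hη : E.η = 2) {j : ℕ} {s : State n m K} {i : Fin n} {v : Fin n ⊕ Fin m}
    {j' : ℕ} : v ∈ (E.play j s i).block j' ↔ v ∈ (s i).block j' ∨
      ∃ r, (s i).lastRec = some (v, r) ∧ 1 < j ∧ E.best j i (E.playPhase j i (s i)) ≠ r ∧
        j ≤ j' ∧ j' ≤ j ^ 2 := by
  have hceil : ⌈(j : ℝ) ^ E.η⌉₊ = j ^ 2 := by
    rw [hη, Real.rpow_ofNat]
    exact_mod_cast Nat.ceil_natCast (R := ℝ) (j ^ 2)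
  have hl : (E.playPhase j i (s i)).lastRec = (s i).lastRec := rfl
  have hb : (E.playPhase j i (s i)).block = (s i).block := rfl
  simp only [play, updateBlock, hl, hb, hceil]
  rcases h : (s i).lastRec with _ | ⟨h', r'⟩
  · simp
  · simp only [Option.some.injEq, Prod.mk.injEq]
    split_ifs with hc
    · rw [Finset.mem_insert]
      constructor
      · rintro (rfl | hv)
        · exact Or.inr ⟨r', ⟨rfl, rfl⟩, hc⟩
        · exact Or.inl hv
      · rintro (hv | ⟨r, ⟨rfl, rfl⟩, -⟩)
        · exact Or.inr hv
        · exact Or.inl rfl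
    · constructor
      · exact Or.inl
      · rintro (hv | ⟨r, ⟨rfl, rfl⟩, hc'⟩)
        · exact hv
        · exact absurd hc' hc

theorem some_mem_contacts {j : ℕ} {i : Fin n} {a : AgentState n m K} {v : Fin n ⊕ Fin m} :
    some v ∈ E.contacts j i a ↔ E.G.Adj (Sum.inl i) v ∧ v ∉ a.block j := by
  unfold contacts
  split_ifs with h
  · simp [available]
  · rw [Finset.not_nonempty_iff_eq_empty] at h
    have : v ∉ E.available j i a := by simp [h]
    simpa [available] using this

theorem active_nonempty (i : Fin n) (a : AgentState n m K) : (E.active i a).Nonempty :=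
  ⟨a.U, by simp [active]⟩

theorem best_mem (j : ℕ) (i : Fin n) (a : AgentState n m K) : E.best j i a ∈ E.active i a :=
  argmaxOn_mem _ _ (E.active_nonempty i a)

section Communicate

variable (mal : Strategy n m K) (j : ℕ) (s : State n m K) (c : Fin n → Option (Fin n ⊕ Fin m))
  (i : Fin n)

theorem pulls_communicate : (E.communicate mal j s c i).pulls = (s i).pulls := by
  unfold communicate receive
  rcases c i with _ | v
  · rfl
  · simp only [Option.map_some]; split_ifs <;> rfl

theorem block_communicate : (E.communicate mal j s c i).block = (s i).block := by
  unfold communicate receive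
  rcases c i with _ | v
  · rfl
  · simp only [Option.map_some]; split_ifs <;> rfl

theorem lastRec_communicate : (E.communicate mal j s c i).lastRec =
    (c i).map fun v => (v, E.recommend mal j s i v) := by
  unfold communicate receive
  rcases c i with _ | v
  · rfl
  · simp only [Option.map_some]; split_ifs <;> rfl

variable {mal j s c i}

theorem mem_active_communicate {k : Fin K}
    (hk : k ∈ E.active i (E.communicate mal j s c i)) :
    k ∈ E.active i (s i) ∨ ∃ v, c i = some v ∧ k = E.recommend mal j s i v := by
  unfold communicate receive at hk
  rcases hc : c i with _ | v
  · rw [hc] at hk; exact Or.inl hk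
  · rw [hc] at hk
    simp only [Option.map_some] at hk
    split_ifs at hk with h
    · exact Or.inl hk
    · have hU := argmaxOn_mem (E.tieKeep i j) (S := {(s i).U, (s i).L}) (E.phasePulls j (s i).pulls)
        (by simp)
      simp only [active, Finset.mem_union, Finset.mem_insert, Finset.mem_singleton] at hk hU ⊢
      rcases hk with hk | hk | hk
      · tauto
      · rw [← hk] at hU; tauto
      · exact Or.inr ⟨v, rfl, hk⟩

theorem recommend_mem_active_communicate {v : Fin n ⊕ Fin m} (hc : c i = some v) :
    E.recommend mal j s i v ∈ E.active i (E.communicate mal j s c i) := by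
  unfold communicate receive
  rw [hc]
  simp only [Option.map_some]
  split_ifs with h
  · exact h
  · simp [active]

theorem active_communicate_eq {v : Fin n ⊕ Fin m} (hc : c i = some v)
    (h : E.recommend mal j s i v ∈ E.active i (s i)) :
    E.active i (E.communicate mal j s c i) = E.active i (s i) := by
  unfold communicate receive
  rw [hc]
  simp only [Option.map_some]
  rw [if_pos h]
  rfl

/-- Only the less played non-sticky arm is ever discarded; a strict maximizer is kept whatever the
tie-breaking rule. -/
theorem mem_active_communicate_of_mostPlayed {k : Fin K} (hk : k ∈ E.active i (s i))
    (hk' : k ∉ E.sticky i)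
    (hmax : ∀ k' ∈ E.active i (s i), k' ≠ k →
      E.phasePulls j (s i).pulls k' < E.phasePulls j (s i).pulls k) :
    k ∈ E.active i (E.communicate mal j s c i) := by
  unfold communicate receive
  rcases c i with _ | v
  · exact hk
  · simp only [Option.map_some]
    split_ifs with h
    · exact hk
    · have hUL : k ∈ ({(s i).U, (s i).L} : Finset (Fin K)) := by
        rw [active, Finset.mem_union] at hk
        exact hk.resolve_left hk'
      have := argmaxOn_eq (E.tieKeep i j) (E.phasePulls j (s i).pulls) hUL fun k' hk1 hk2 =>
        hmax k' (Finset.mem_union_right _ hk1) hk2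
      simp [active, this]

end Communicate

end Setup

/-! ### Gaps between the arm means -/

section Means

/-- Since 2^(h+1) ≥ 4h, the terms are dominated by the geometric series of ratio 1/16. The bound
1/15 keeps every other arm at distance at least 1/15 from the best one. -/
theorem sum_inv_two_pow_two_pow_le (M : ℕ) :
    ∑ h ∈ Finset.Icc 1 M, ((2 : ℝ) ^ (2 ^ (h + 1)))⁻¹ ≤ (1 - (16 ^ M)⁻¹) / 15 := by
  induction M with
  | zero => simp
  | succ M ih =>
    rw [Finset.sum_Icc_succ_top (by omega)]
    have h1 : ((2 : ℝ) ^ (2 ^ (M + 1 + 1)))⁻¹ ≤ (16 ^ (M + 1))⁻¹ := by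
      apply inv_anti₀ (by positivity)
      have : M + 1 < 2 ^ (M + 1) := Nat.lt_two_pow_self
      have h2 : 4 * (M + 1) ≤ 2 ^ (M + 1 + 1) := by
        have : M + 1 ≤ 2 ^ M := Nat.lt_two_pow_self
        rw [pow_succ, pow_succ]; omega
      calc (16 : ℝ) ^ (M + 1) = 2 ^ (4 * (M + 1)) := by rw [pow_mul]; norm_num
        _ ≤ _ := pow_le_pow_right₀ (by norm_num) h2
    have h3 : ((16 : ℝ) ^ (M + 1))⁻¹ = (16 ^ M)⁻¹ / 16 := by rw [pow_succ, mul_inv]; ring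
    rw [h3] at h1 ⊢
    linarith

theorem badMean_one (n : ℕ) : badMean n 1 = 1 := by simp [badMean]

theorem badMean_le (n : ℕ) {k : ℕ} (hk : k ≠ 1) : badMean n k ≤ 14 / 15 := by
  unfold badMean
  rw [if_neg hk]
  split_ifs
  · have := sum_inv_two_pow_two_pow_le (n / 2 - k)
    have : (0 : ℝ) < (16 ^ (n / 2 - k))⁻¹ := by positivity
    linarith
  · norm_num

theorem badMean_le_one (n k : ℕ) : badMean n k ≤ 1 := by
  rcases eq_or_ne k 1 with rfl | hk
  · rw [badMean_one]
  · linarith [badMean_le n hk]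

theorem badMean_eq_zero {n k : ℕ} (hk : k ≠ 1) (h : n / 2 < k) : badMean n k = 0 := by
  rw [badMean, if_neg hk, if_neg (by omega)]

/-- An upper bound for the inverse squared gap between the `l`-th best arm that is used in an attack
and all worse arms. -/
def invSqGap (l : ℕ) : ℝ := if l = 1 then 2 else 2 ^ (2 ^ (l + 1))

theorem invSqGap_nonneg (l : ℕ) : 0 ≤ invSqGap l := by
  unfold invSqGap; split_ifs <;> positivity

/-- A worse arm of positive mean misses at least the last summand, 2^-(2^l), of the better one. This
occurs only for `l ≥ 2`; otherwise the worse arm has mean 0 and the gap is at least 13/15. -/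
theorem badMean_gap {n l k k' : ℕ} (hl : 1 ≤ l) (hln : l < n / 2) (hk : k + l = n / 2)
    (hk' : n / 2 < k' + l) : badMean n (k' + 1) < badMean n (k + 1) ∧
      1 ≤ invSqGap l * (badMean n (k + 1) - badMean n (k' + 1)) ^ 2 := by
  have hmk : badMean n (k + 1) =
      13 / 15 + ∑ h ∈ Finset.Icc 1 (l - 1), ((2 : ℝ) ^ (2 ^ (h + 1)))⁻¹ := by
    rw [badMean, if_neg (by omega), if_pos (by omega)]
    congr 3
    omega
  rcases Nat.lt_or_ge k' (n / 2) with h | h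
  · have hmk' : badMean n (k' + 1) =
        13 / 15 + ∑ h ∈ Finset.Icc 1 (n / 2 - (k' + 1)), ((2 : ℝ) ^ (2 ^ (h + 1)))⁻¹ := by
      rw [badMean, if_neg (by omega), if_pos (by omega)]
    have hsum : ∑ h ∈ Finset.Icc 1 (n / 2 - (k' + 1)), ((2 : ℝ) ^ (2 ^ (h + 1)))⁻¹ +
        ((2 : ℝ) ^ (2 ^ l))⁻¹ ≤ ∑ h ∈ Finset.Icc 1 (l - 1), ((2 : ℝ) ^ (2 ^ (h + 1)))⁻¹ := by
      obtain ⟨q, rfl⟩ : ∃ q, l = q + 2 := ⟨l - 2, by omega⟩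
      rw [show q + 2 - 1 = q + 1 by omega, Finset.sum_Icc_succ_top (by omega)]
      gcongr
      omega
    have hpos : (0 : ℝ) < ((2 : ℝ) ^ (2 ^ l))⁻¹ := by positivity
    have hgap : ((2 : ℝ) ^ (2 ^ l))⁻¹ ≤ badMean n (k + 1) - badMean n (k' + 1) := by
      rw [hmk, hmk']; linarith
    refine ⟨by linarith, ?_⟩
    rw [invSqGap, if_neg (by omega)]
    calc (1 : ℝ) = 2 ^ (2 ^ (l + 1)) * (((2 : ℝ) ^ (2 ^ l))⁻¹) ^ 2 := by
          rw [inv_pow, ← pow_mul, ← pow_succ, mul_inv_cancel₀ (by positivity)]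
      _ ≤ _ := by gcongr
  · rw [badMean_eq_zero (by omega) (by omega)]
    have h1 : 13 / 15 ≤ badMean n (k + 1) := by
      rw [hmk]
      have : 0 ≤ ∑ h ∈ Finset.Icc 1 (l - 1), ((2 : ℝ) ^ (2 ^ (h + 1)))⁻¹ := by positivity
      linarith
    have h2 : (2 : ℝ) ≤ invSqGap l := by
      unfold invSqGap
      split_ifs
      · rfl
      · calc (2 : ℝ) = 2 ^ 1 := by norm_num
          _ ≤ _ := pow_le_pow_right₀ (by norm_num) Nat.one_le_two_pow
    refine ⟨by linarith, ?_⟩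
    rw [sub_zero]
    nlinarith

end Means

/-! ### Growth of the attack phases -/

section Phases

theorem badPhase_succ {l : ℕ} (hl : 1 ≤ l) : badPhase (l + 1) = (badPhase l + 2) ^ 2 := by
  obtain ⟨q, rfl⟩ : ∃ q, l = q + 1 := ⟨l - 1, by omega⟩
  rfl

theorem badPhase_add_lt (l : ℕ) : badPhase l + 3 < badPhase (l + 1) := by
  rcases Nat.eq_zero_or_pos l with rfl | hl
  · simp [badPhase]
  · rw [badPhase_succ hl]; nlinarith

theorem badPhase_strictMono : StrictMono badPhase :=
  strictMono_nat_of_lt_succ fun l => by have := badPhase_add_lt l; omega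

/-- Any block imposed by the time of one attack has expired when the next attack starts. -/
theorem sq_badPhase_lt {l : ℕ} : badPhase l ^ 2 < badPhase (l + 1) := by
  rcases Nat.eq_zero_or_pos l with rfl | hl
  · simp [badPhase]
  · rw [badPhase_succ hl]; exact Nat.pow_lt_pow_left (by omega) (by omega)

theorem two_pow_le_badPhase {l : ℕ} (hl : 1 ≤ l) : 2 ^ (2 ^ (l + 2)) ≤ badPhase l := by
  induction l, hl using Nat.le_induction with
  | base => norm_num [badPhase]
  | succ l hl ih =>
    rw [badPhase_succ hl, show l + 1 + 2 = (l + 2) + 1 by omega, pow_succ 2 (l + 2), pow_mul]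
    exact Nat.pow_le_pow_left (by omega) 2

/-- Tangent line of the logarithm at 256, where 8 log 2 - 1 < 4.546. -/
theorem log_le_of_pos {x : ℝ} (hx : 0 < x) : Real.log x ≤ 4.546 + x / 256 := by
  have h1 := Real.log_le_sub_one_of_pos (x := x / 256) (by positivity)
  rw [Real.log_div hx.ne' (by norm_num), show (256 : ℝ) = 2 ^ 8 by norm_num, Real.log_pow] at h1
  have := Real.log_two_lt_d9
  norm_num at h1 ⊢
  linarith

/-- This is `3 * B < 2 * p - 1` for the pull bound `B = 8 * (invSqGap l * log p) + 1` of a worse arm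
in phase `p`, which has length `2 * p - 1`. For `l ≥ 2` the inverse squared gap is at most `√p`, by
the doubly exponential growth of the attack phases. -/
theorem invSqGap_mul_log_lt {l p : ℕ} (hl : 1 ≤ l) (hp : badPhase l < p) :
    12 * (invSqGap l * Real.log p) + 2 < p := by
  rcases Nat.lt_or_ge 1 l with h | h
  · rw [invSqGap, if_neg (by omega)]
    have h1 : (2 : ℝ) ^ (2 ^ (l + 2)) ≤ p := by
      exact_mod_cast (two_pow_le_badPhase hl).trans hp.le
    rw [pow_succ 2 (l + 1), pow_mul] at h1
    set D : ℝ := 2 ^ (2 ^ (l + 1)) with hD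
    have hD256 : 256 ≤ D := by
      calc (256 : ℝ) = 2 ^ (2 ^ 3) := by norm_num
        _ ≤ _ := pow_le_pow_right₀ (by norm_num) (Nat.pow_le_pow_right (by norm_num) (by omega))
    set x : ℝ := Real.sqrt p with hx
    have hDx : D ≤ x := Real.le_sqrt_of_sq_le h1
    have hxp : x ^ 2 = p := Real.sq_sqrt (Nat.cast_nonneg _)
    have hlog : Real.log p = 2 * Real.log x := by rw [← hxp, Real.log_pow]; norm_num
    have hlx := log_le_of_pos (x := x) (by linarith)
    have hlx0 : 0 ≤ Real.log x := Real.log_nonneg (by linarith)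
    rw [hlog, ← hxp]
    have : D * (2 * Real.log x) ≤ x * (2 * (4.546 + x / 256)) := by gcongr
    norm_num at this
    nlinarith
  · obtain rfl : l = 1 := by omega
    have h1 : (257 : ℝ) ≤ p := by exact_mod_cast hp
    have := log_le_of_pos (x := p) (by linarith)
    rw [invSqGap, if_pos rfl]
    norm_num at this
    linarith

end Phases

/-! ### The best active arm is played most in late phases -/

section MostPlayed

/-- The properties of the bad instance that matter for the lower bound. -/
structure IsBadInstance {n : ℕ} (E : Setup n 1 n) : Prop where
  G_eq : E.G = badGraph n
  μ_eq : ∀ k, E.μ k = badMean n (k.val + 1)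
  α_eq : E.α = 4
  β_eq : E.β = 2
  η_eq : E.η = 2
  card_sticky : ∀ i, (E.sticky i).card = 1
  le_of_mem_init : ∀ i : Fin n, n / 2 ≤ i.val → ∀ k ∈ E.sticky i ∪ {E.U₁ i, E.L₁ i}, n / 2 ≤ k.val

theorem isBadInstance_badSetup {n : ℕ} {sticky : Fin n → Finset (Fin n)} {U₁ L₁ : Fin n → Fin n}
    (h : BadInit n sticky U₁ L₁) (tieUCB tieBest tieKeep : Fin n → ℕ → TieBreak n) :
    IsBadInstance (badSetup n sticky U₁ L₁ tieUCB tieBest tieKeep) where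
  G_eq := rfl
  μ_eq _ := rfl
  α_eq := rfl
  β_eq := rfl
  η_eq := rfl
  card_sticky i := (h.1 i).1
  le_of_mem_init i hi k hk := Nat.lt_succ_iff.1 (h.2 i (Nat.lt_succ_of_le hi) k hk)

variable {n : ℕ} {E : Setup n 1 n} (hE : IsBadInstance E)

include hE

theorem isUCBPull_runPhase (i : Fin n) {p : ℕ} {S : Finset (Fin n)} (hS : S.Nonempty)
    (I : ℕ → Fin n) {u : ℕ} (hu : (p - 1) ^ 2 < u) (hup : u ≤ p ^ 2) :
    E.IsUCBPull S (E.runPhase i p S I) u := by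
  unfold Setup.runPhase
  rw [E.commTime_eq hE.β_eq, E.commTime_eq hE.β_eq]
  exact Setup.isUCBPull_runUCB _ i hS _ _ _ hu (by omega)

theorem runPhase_of_le (i : Fin n) {p : ℕ} (S : Finset (Fin n))
    (I : ℕ → Fin n) {u : ℕ} (hu : u ≤ (p - 1) ^ 2) :
    E.runPhase i p S I u = I u := by
  unfold Setup.runPhase
  rw [E.commTime_eq hE.β_eq, E.commTime_eq hE.β_eq]
  exact Setup.runUCB_of_le _ i _ _ _ _ hu

/-- The best active arm is the most played one, if the phase is so late that its gap to the worse
arms can be detected in one phase. -/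
theorem phasePulls_lt (i : Fin n) {l p : ℕ} (hl : 1 ≤ l) (hln : l < n / 2) (hp : badPhase l < p)
    {S : Finset (Fin n)} (hS : S.card ≤ 3) (hSl : ∀ k ∈ S, n / 2 ≤ k.val + l) {k₀ : Fin n}
    (hk₀ : k₀ ∈ S) (hk₀l : k₀.val + l = n / 2) (I : ℕ → Fin n) {k : Fin n} (hk : k ∈ S)
    (hne : k ≠ k₀) :
    E.phasePulls p (E.runPhase i p S I) k <
      E.phasePulls p (E.runPhase i p S I) k₀ := by
  set J := E.runPhase i p S I with hJ
  have hp1 : 1 ≤ p := by omega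
  have hab : (p - 1) ^ 2 ≤ p ^ 2 := Nat.pow_le_pow_left (by omega) 2
  have hU : ∀ u, (p - 1) ^ 2 < u → u ≤ p ^ 2 → E.IsUCBPull S J u := fun u hu hup =>
    isUCBPull_runPhase hE i ⟨k₀, hk₀⟩ I hu hup
  have hpull : ∀ k', E.phasePulls p J k' =
      numPulls J k' (p ^ 2) - numPulls J k' ((p - 1) ^ 2) := fun k' => by
    unfold Setup.phasePulls
    rw [E.commTime_eq hE.β_eq, E.commTime_eq hE.β_eq]
  have hlog : Real.log ((p ^ 2 : ℕ) : ℝ) = 2 * Real.log p := by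
    push_cast; rw [Real.log_pow]; norm_num
  -- The factor 8 is `α = 4` times the 2 from `log (p ^ 2)`.
  set B := 8 * (invSqGap l * Real.log p) + 1 with hB
  have hbad : ∀ k' ∈ S, k' ≠ k₀ → (E.phasePulls p J k' : ℝ) ≤ B := by
    intro k' hk' hne'
    have hlt : n / 2 < k'.val + l := by
      have := hSl k' hk'
      have : k'.val ≠ k₀.val := fun h => hne' (Fin.ext h)
      omega
    obtain ⟨h1, h2⟩ := badMean_gap hl hln hk₀l hlt
    rw [hpull]
    have hα := hE.α_eq
    rw [← hE.μ_eq, ← hE.μ_eq] at h1 h2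
    refine (Setup.numPulls_sub_le_of_isUCBPull _ hab hU (by rw [hα]; norm_num) hk₀ h1 h2).trans ?_
    rw [hlog, hα, hB]
    linarith
  have hlen : p ^ 2 - (p - 1) ^ 2 = 2 * p - 1 := by
    obtain ⟨q, rfl⟩ : ∃ q, p = q + 1 := ⟨p - 1, by omega⟩
    rw [Nat.add_sub_cancel, Nat.sub_eq_iff_eq_add (by nlinarith)]
    have : 2 * (q + 1) - 1 = 2 * q + 1 := by omega
    rw [this]; ring
  have hsum := sum_numPulls hab fun u hu hup => (hU u hu hup).1
  rw [hlen, ← Finset.sum_congr rfl fun k' _ => hpull k', ← Finset.add_sum_erase _ _ hk₀] at hsum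
  have hBpos : 0 ≤ B := by
    have := mul_nonneg (invSqGap_nonneg l) (Real.log_natCast_nonneg p)
    rw [hB]; linarith
  -- At most two other arms are active, so `k₀` gets at least `2 * p - 1 - 2 * B` pulls, which is
  -- more than `B`.
  have hrest : ((∑ k' ∈ S.erase k₀, E.phasePulls p J k' : ℕ) : ℝ) ≤ 2 * B := by
    rw [Nat.cast_sum]
    refine (Finset.sum_le_card_nsmul _ _ B fun k' hk' =>
      hbad k' (Finset.mem_of_mem_erase hk') (Finset.ne_of_mem_erase hk')).trans ?_
    rw [nsmul_eq_mul]
    have : ((S.erase k₀).card : ℝ) ≤ 2 := by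
      rw [Finset.card_erase_of_mem hk₀]; exact_mod_cast (by omega : S.card - 1 ≤ 2)
    gcongr
  have hsum' : (E.phasePulls p J k₀ : ℝ) +
      ((∑ k' ∈ S.erase k₀, E.phasePulls p J k' : ℕ) : ℝ) = 2 * p - 1 := by
    have : ((2 * p - 1 : ℕ) : ℝ) = 2 * p - 1 := by
      rw [Nat.cast_sub (by omega)]; push_cast; rfl
    rw [← this, ← hsum]; push_cast; rfl
  have hnum := invSqGap_mul_log_lt hl hp
  have hkB := hbad k hk hne
  have : (E.phasePulls p J k : ℝ) < E.phasePulls p J k₀ := by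
    rw [hB] at *
    linarith
  exact_mod_cast this

end MostPlayed

/-! ### Recommendations of the malicious agent -/

section Attack

theorem IsAttack.eq_succ {n p l l' : ℕ} {i : Fin n} (h : IsAttack n p i l') (hp : badPhase l < p)
    (hp' : p ≤ badPhase (l + 1)) : l' = l + 1 := by
  obtain ⟨-, -, rfl, -⟩ := h
  have h1 := badPhase_strictMono.lt_iff_lt.1 hp
  have h2 := badPhase_strictMono.le_iff_le.1 hp'
  omega

variable {n : ℕ} (E : Setup n 1 n) (q : Fin 1) (p : ℕ) (s : State n 1 n) (i : Fin n)

theorem badStrategy_of_not_isAttack (h : ¬∃ l, IsAttack n p i l) :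
    badStrategy E q p s i =
      E.mostPlayed i (p + 1) (E.active i (s i))
        (E.runPhase i (p + 1) (E.active i (s i)) (s i).pulls) := by
  rw [badStrategy, dif_neg h]

theorem badStrategy_of_isAttack {l : ℕ} (h : IsAttack n p i l) :
    (badStrategy E q p s i).val + l = n / 2 := by
  classical
  have hex : ∃ l, IsAttack n p i l := ⟨l, h⟩
  have hfind : IsAttack n p i (Nat.find hex) := Nat.find_spec hex
  have heq : Nat.find hex = l :=
    badPhase_strictMono.injective (hfind.2.2.1.symm.trans h.2.2.1)
  rw [badStrategy, dif_pos hex]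
  have h2 := h.2.1
  simp only
  convert_to n / 2 - Nat.find hex + l = n / 2
  omega

variable {p i} in
/-- Outside of an attack, the malicious agent recommends what will be played most. -/
theorem best_of_contact_malicious {c : Fin n → Option (Fin n ⊕ Fin 1)} (hc : c i = some (Sum.inr q))
    (h : ¬∃ l, IsAttack n p i l) :
    E.active i (E.communicate (badStrategy E) p s c i) = E.active i (s i) ∧
      E.best (p + 1) i (E.playPhase (p + 1) i (E.communicate (badStrategy E) p s c i)) =
        badStrategy E q p s i := by
  have hact : E.active i (E.communicate (badStrategy E) p s c i) = E.active i (s i) := by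
    refine Setup.active_communicate_eq E hc ?_
    change badStrategy E q p s i ∈ _
    rw [badStrategy_of_not_isAttack E q p s i h]
    exact argmaxOn_mem _ _ (E.active_nonempty _ _)
  refine ⟨hact, ?_⟩
  rw [badStrategy_of_not_isAttack E q p s i h]
  change E.mostPlayed i (p + 1) (E.active i (E.communicate (badStrategy E) p s c i))
    (E.runPhase i (p + 1) (E.active i (E.communicate (badStrategy E) p s c i))
      (E.communicate (badStrategy E) p s c i).pulls) = _
  rw [hact, Setup.pulls_communicate]

end Attack

/-! ### Number of possible contacts -/

section Graph

variable {n : ℕ}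

theorem badGraph_adj_inl {a b : Fin n} : (badGraph n).Adj (Sum.inl a) (Sum.inl b) ↔
    a.val + 1 = b.val ∨ b.val + 1 = a.val := by
  rw [badGraph, SimpleGraph.fromRel_adj]
  constructor
  · exact fun h => h.2
  · intro h
    refine ⟨fun hab => ?_, h⟩
    obtain rfl := Sum.inl_injective hab
    omega

theorem badGraph_adj_inr {a : Fin n} {q : Fin 1} : (badGraph n).Adj (Sum.inl a) (Sum.inr q) := by
  rw [badGraph, SimpleGraph.fromRel_adj]
  exact ⟨Sum.inl_ne_inr, Or.inl trivial⟩

theorem card_contacts_le (E : Setup n 1 n) (hE : E.G = badGraph n) (p : ℕ) (i : Fin n)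
    (a : AgentState n 1 n) : (E.contacts p i a).card ≤ 3 := by
  classical
  unfold Setup.contacts
  split_ifs with h
  · rw [Finset.card_map]
    -- The malicious vertex gets the unused number `n`; for `i = 0` the truncated `i - 1` below is
    -- merely a superfluous element.
    let f : Fin n ⊕ Fin 1 → ℕ := Sum.elim Fin.val fun _ => n
    have hf : Function.Injective f := by
      rintro (x | x) (y | y) hxy
      · exact congrArg _ (Fin.ext hxy)
      · exact absurd hxy x.isLt.ne
      · exact absurd hxy.symm y.isLt.ne
      · exact congrArg _ (Subsingleton.elim _ _)
    rw [← Finset.card_image_of_injective _ hf]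
    have hsub : (E.available p i a).image f ⊆ {i.val + 1, i.val - 1, n} := by
      intro x hx
      obtain ⟨v, hv, rfl⟩ := Finset.mem_image.1 hx
      have hadj := (by simpa [Setup.available] using hv : _ ∧ _).1
      rw [hE] at hadj
      rcases v with b | b
      · have := badGraph_adj_inl.1 hadj
        simp only [f, Sum.elim_inl, Finset.mem_insert, Finset.mem_singleton]
        omega
      · simp [f]
    exact (Finset.card_le_card hsub).trans Finset.card_le_three
  · simp

end Graph

/-! ### The moving frontier -/

section Invariant

/-- The state of affairs after phase `j`, for `J_l ≤ j < J_{l+1}`, on the event that the attacks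
worked so far: from agent `n / 2 + l` (counted from `0`) on, nobody knows any of the best arms, and
this agent blocks its left neighbor. -/
structure StageInv {n : ℕ} (E : Setup n 1 n) (l j : ℕ) (s : State n 1 n) : Prop where
  block_le : ∀ i v j', v ∈ (s i).block j' → j' ≤ j ^ 2
  level_le : ∀ i : Fin n, n / 2 + l ≤ i.val → ∀ k ∈ E.active i (s i), n / 2 ≤ k.val + l
  mal_free : ∀ i : Fin n, n / 2 + l ≤ i.val → ∀ j', Sum.inr 0 ∉ (s i).block j'
  mal_rec : ∀ i : Fin n, n / 2 + l ≤ i.val → ∀ r, (s i).lastRec = some (Sum.inr 0, r) →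
    E.best (j + 1) i (E.playPhase (j + 1) i (s i)) = r
  has_arm : 1 ≤ l → ∀ i : Fin n, (i.val = n / 2 + l ∨ i.val = n / 2 + l + 1) →
    ∀ k : Fin n, k.val + l = n / 2 → k ∈ E.active i (s i)
  -- The right neighbor of the front is the next front. It must be able to contact the present front
  -- just after the next attack, so it may not block it beyond that attack.
  next_free : ∀ i h : Fin n, i.val = n / 2 + l + 1 → h.val = n / 2 + l →
    ∀ j', badPhase (l + 1) < j' → Sum.inl h ∉ (s i).block j'
  next_rec : ∀ i h : Fin n, i.val = n / 2 + l + 1 → h.val = n / 2 + l →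
    ∀ r, (s i).lastRec = some (Sum.inl h, r) → 1 ≤ l ∧ r.val + l = n / 2
  -- The last three fields follow the front and its left neighbor: contact still possible, worse arm
  -- received, neighbor blocked.
  fresh : 1 ≤ l → j = badPhase l → ∀ i h : Fin n, i.val = n / 2 + l → h.val + 1 = n / 2 + l →
    (∀ j', badPhase l < j' → Sum.inl h ∉ (s i).block j') ∧
    (∀ r, (s i).lastRec ≠ some (Sum.inl h, r)) ∧ ∀ k ∈ E.active h (s h), n / 2 < k.val + l
  second : 1 ≤ l → j = badPhase l + 1 → ∀ i h : Fin n, i.val = n / 2 + l →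
    h.val + 1 = n / 2 + l → ∃ r, (s i).lastRec = some (Sum.inl h, r) ∧ n / 2 < r.val + l
  blocked : 1 ≤ l → badPhase l + 2 ≤ j → ∀ i h : Fin n, i.val = n / 2 + l →
    h.val + 1 = n / 2 + l → ∀ j', j < j' → j' ≤ badPhase (l + 1) → Sum.inl h ∈ (s i).block j'

/-- The contacts at the end of phase `j + 1` that make the next attack succeed. -/
structure GoodContacts {n : ℕ} (l j : ℕ) (c : Fin n → Option (Fin n ⊕ Fin 1)) : Prop where
  early : l = 0 → ∀ i : Fin n, n / 2 ≤ i.val → i.val ≤ n / 2 + 2 → c i = some (Sum.inr 0)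
  attack : j + 1 = badPhase (l + 1) → ∀ i : Fin n,
    (i.val = n / 2 + l + 1 ∨ i.val = n / 2 + l + 2) → c i = some (Sum.inr 0)
  left : 1 ≤ l → j = badPhase l → ∀ i h : Fin n, i.val = n / 2 + l → h.val + 1 = n / 2 + l →
    c i = some (Sum.inl h)

variable {n : ℕ} {E : Setup n 1 n} (hE : IsBadInstance E)

include hE in
theorem card_active_le (i : Fin n) (a : AgentState n 1 n) :
    (E.active i a).card ≤ 3 := by
  refine (Finset.card_union_le _ _).trans ?_
  have h1 : (E.sticky i).card = 1 := hE.card_sticky i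
  have h2 : ({a.U, a.L} : Finset (Fin n)).card ≤ 2 := Finset.card_le_two
  omega

include hE in
-- Turns `phasePulls_lt` into a statement independent of tie-breaking, as the maximum is strict.
theorem best_eq (i : Fin n) {l p : ℕ} (hl : 1 ≤ l)
    (hln : l < n / 2) (hp : badPhase l < p) {a : AgentState n 1 n}
    (hal : ∀ k ∈ E.active i a, n / 2 ≤ k.val + l) {k₀ : Fin n}
    (hk₀ : k₀ ∈ E.active i a) (hk₀l : k₀.val + l = n / 2) :
    E.best p i (E.playPhase p i a) = k₀ :=
  argmaxOn_eq _ _ hk₀ fun _ hk hne =>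
    phasePulls_lt hE i hl hln hp (card_active_le hE i a) hal hk₀ hk₀l a.pulls hk hne

include hE in
theorem stageInv_initState : StageInv E 0 0 (E.initState) where
  block_le i v j' h := by simp [Setup.initState] at h
  level_le i hi k hk := by
    exact hE.le_of_mem_init i (by omega) k hk
  mal_free i hi j' h := by simp [Setup.initState] at h
  mal_rec i hi r h := by simp [Setup.initState] at h
  has_arm h := by omega
  next_free i h hi hh j' hj' hb := by simp [Setup.initState] at hb
  next_rec i h hi hh r hr := by simp [Setup.initState] at hr
  fresh h := by omega
  second h := by omega
  blocked h := by omega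

section Step

variable {l j : ℕ} {s : State n 1 n} (hI : StageInv E l j s) (hln : l < n / 2) (hj : badPhase l ≤ j)
  (hj' : j + 1 ≤ badPhase (l + 1)) {c : Fin n → Option (Fin n ⊕ Fin 1)}
  (hc : ∀ i, c i ∈ E.contacts (j + 1) i (E.play (j + 1) s i))
  (hg : GoodContacts l j c)

include hE hI in
theorem StageInv.block_play_le {i : Fin n} {v : Fin n ⊕ Fin 1} {j' : ℕ}
    (h : v ∈ (E.play (j + 1) s i).block j') : j' ≤ (j + 1) ^ 2 := by
  rcases (E.mem_block_play hE.η_eq).1 h with h | ⟨r, -, -, -, -, h⟩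
  · exact (hI.block_le _ _ _ h).trans (Nat.pow_le_pow_left (by omega) 2)
  · exact h

include hE hI in
theorem StageInv.mal_free_play {i : Fin n} (hi : n / 2 + l ≤ i.val) (j' : ℕ) :
    Sum.inr 0 ∉ (E.play (j + 1) s i).block j' := by
  intro h
  rcases (E.mem_block_play hE.η_eq).1 h with h | ⟨r, hr, -, hne, -⟩
  · exact hI.mal_free i hi _ h
  · exact hne (hI.mal_rec i hi r hr)

include hE hI hln hj in
theorem StageInv.best_play (hl : 1 ≤ l) {i : Fin n}
    (hi : i.val = n / 2 + l ∨ i.val = n / 2 + l + 1) {k : Fin n} (hk : k.val + l = n / 2) :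
    E.best (j + 1) i (E.playPhase (j + 1) i (s i)) = k :=
  best_eq hE i hl hln (by omega) (hI.level_le i (by omega)) (hI.has_arm hl i hi k hk) hk

include hE hI hln hj in
theorem StageInv.next_free_play {i h : Fin n} (hi : i.val = n / 2 + l + 1)
    (hh : h.val = n / 2 + l) {j' : ℕ} (hb : badPhase (l + 1) < j') :
    Sum.inl h ∉ (E.play (j + 1) s i).block j' := by
  intro hmem
  rcases (E.mem_block_play hE.η_eq).1 hmem with hmem | ⟨r, hr, -, hne, -⟩
  · exact hI.next_free i h hi hh _ hb hmem
  · obtain ⟨hl, hrl⟩ := hI.next_rec i h hi hh r hr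
    exact hne (hI.best_play hE hln hj hl (Or.inr hi) hrl)

include hE hI hln hj in
-- The block is imposed in phase `badPhase l + 2`, because of the worse arm received one phase
-- before; afterwards it merely persists.
theorem StageInv.left_blocked (hl : 1 ≤ l) (hj2 : badPhase l + 1 ≤ j) {i h : Fin n}
    (hi : i.val = n / 2 + l) (hh : h.val + 1 = n / 2 + l) {j' : ℕ} (hjj : j + 1 ≤ j')
    (hjb : j' ≤ badPhase (l + 1)) : Sum.inl h ∈ (E.play (j + 1) s i).block j' := by
  rw [E.mem_block_play hE.η_eq]
  rcases Nat.eq_or_lt_of_le hj2 with hj2 | hj2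
  · obtain ⟨r, hr, hrl⟩ := hI.second hl hj2.symm i h hi hh
    refine Or.inr ⟨r, hr, by omega, ?_, by omega, ?_⟩
    · rw [hI.best_play hE hln hj hl (Or.inl hi) (k := ⟨n / 2 - l, by omega⟩)
        (Nat.sub_add_cancel hln.le)]
      intro heq
      have := congrArg Fin.val heq
      simp only at this
      omega
    -- The block lasts up to the square of the current phase, which is exactly the next attack
    -- phase: this is the origin of the recursion defining `badPhase`.
    · rw [badPhase_succ hl] at hjb
      rw [← hj2]
      exact hjb
  · exact Or.inl (hI.blocked hl hj2 i h hi hh j' (by omega) hjb)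

include hE hI hln hj hj' hc hg in
/-- Honest agents do not spread better arms to the right of agent `n / 2 + l`. -/
theorem StageInv.contact_inl {i h : Fin n} (hi : n / 2 + l ≤ i.val) (hci : c i = some (Sum.inl h)) :
    n / 2 ≤ (E.best (j + 1) h (E.play (j + 1) s h)).val + l ∧
      (h.val < n / 2 + l → n / 2 < (E.best (j + 1) h (E.play (j + 1) s h)).val + l) := by
  have hmem := hc i
  rw [hci, Setup.some_mem_contacts] at hmem
  obtain ⟨hadj, hnb⟩ := hmem
  have hb : E.best (j + 1) h (E.play (j + 1) s h) ∈ E.active h (s h) :=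
      Setup.best_mem E _ h (E.play (j + 1) s h)
  rcases Nat.lt_or_ge h.val (n / 2 + l) with hlt | hge
  · rw [hE.G_eq] at hadj
    have hadj' := badGraph_adj_inl.1 hadj
    have hi' : i.val = n / 2 + l := by omega
    have hh' : h.val + 1 = n / 2 + l := by omega
    rcases Nat.eq_zero_or_pos l with hl | hl
    · have := hg.early hl i (by omega) (by omega)
      rw [hci] at this
      simp at this
    · rcases Nat.eq_or_lt_of_le hj with hj1 | hj1
      · have := (hI.fresh hl hj1.symm i h hi' hh').2.2 _ hb
        exact ⟨this.le, fun _ => this⟩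
      · exact absurd (hI.left_blocked hE hln hj hl hj1 hi' hh' le_rfl hj') hnb
  · exact ⟨hI.level_le h hge _ hb, fun hlt => by omega⟩

include hE hI hln hj hj' hc hg in
-- A new arm comes from an honest agent, which is harmless by `StageInv.contact_inl`, or from the
-- malicious one, which sends an arm already active unless it attacks.
theorem StageInv.level_communicate {i : Fin n} (hi : n / 2 + l ≤ i.val) {k : Fin n}
    (hk : k ∈ E.active i (E.communicate (badStrategy E) (j + 1) (E.play (j + 1) s) c i)) :
    n / 2 ≤ k.val + l ∨
      (IsAttack n (j + 1) i (l + 1) ∧ k.val + (l + 1) = n / 2) := by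
  rcases Setup.mem_active_communicate E hk with hk | ⟨v, hv, rfl⟩
  · exact Or.inl (hI.level_le i hi k hk)
  · rcases v with h | q
    · exact Or.inl (hI.contact_inl hE hln hj hj' hc hg hi hv).1
    · by_cases hatt : ∃ l', IsAttack n (j + 1) i l'
      · obtain ⟨l', hl'⟩ := hatt
        obtain rfl := hl'.eq_succ (by omega) hj'
        exact Or.inr ⟨hl', badStrategy_of_isAttack E q (j + 1) (E.play (j + 1) s) i hl'⟩
      · rw [(best_of_contact_malicious E q (E.play (j + 1) s) hv hatt).1] at hk
        exact Or.inl (hI.level_le i hi _ hk)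

theorem mal_rec_communicate {i : Fin n} (hatt : ¬∃ l', IsAttack n (j + 1) i l') {r : Fin n}
    (hr : (E.communicate (badStrategy E) (j + 1) (E.play (j + 1) s) c i).lastRec =
      some (Sum.inr 0, r)) :
    E.best (j + 2) i (E.playPhase (j + 2) i
      (E.communicate (badStrategy E) (j + 1) (E.play (j + 1) s) c i)) = r := by
  rw [Setup.lastRec_communicate] at hr
  rcases hci : c i with _ | v
  · simp [hci] at hr
  · rw [hci] at hr
    simp only [Option.map_some, Option.some.injEq, Prod.mk.injEq] at hr
    obtain ⟨rfl, rfl⟩ := hr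
    exact (best_of_contact_malicious E 0 (E.play (j + 1) s) hci hatt).2

theorem lastRec_of_contact {i : Fin n} {v v' : Fin n ⊕ Fin 1} (hv : c i = some v) {r : Fin n}
    (hr : (E.communicate (badStrategy E) (j + 1) (E.play (j + 1) s) c i).lastRec = some (v', r)) :
    v' = v ∧ r = E.recommend (badStrategy E) (j + 1) (E.play (j + 1) s) i v := by
  rw [Setup.lastRec_communicate, hv] at hr
  simp only [Option.map_some, Option.some.injEq, Prod.mk.injEq] at hr
  exact ⟨hr.1.symm, hr.2.symm⟩

theorem contact_of_lastRec {i : Fin n} {v : Fin n ⊕ Fin 1} {r : Fin n}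
    (hr : (E.communicate (badStrategy E) (j + 1) (E.play (j + 1) s) c i).lastRec = some (v, r)) :
    c i = some v ∧ r = E.recommend (badStrategy E) (j + 1) (E.play (j + 1) s) i v := by
  rw [Setup.lastRec_communicate] at hr
  rcases hci : c i with _ | v'
  · simp [hci] at hr
  · rw [hci] at hr
    simp only [Option.map_some, Option.some.injEq, Prod.mk.injEq] at hr
    obtain ⟨rfl, rfl⟩ := hr
    exact ⟨rfl, rfl⟩

include hE hI hln hj hj' hc hg in
-- Within a stage no attack takes place, so the malicious agent changes nothing.
theorem StageInv.succ (hlt : j + 1 < badPhase (l + 1)) : StageInv E l (j + 1)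
    (E.communicate (badStrategy E) (j + 1) (E.play (j + 1) s) c) := by
  have hatt : ∀ i : Fin n, ¬∃ l', IsAttack n (j + 1) i l' := by
    rintro i ⟨l', hl'⟩
    obtain rfl := hl'.eq_succ (l := l) (by omega) hj'
    exact hlt.ne hl'.2.2.1
  refine ⟨?_, ?_, ?_, ?_, ?_, ?_, ?_, ?_, ?_, ?_⟩
  · intro i v j' h
    rw [Setup.block_communicate] at h
    exact hI.block_play_le hE h
  · intro i hi k hk
    rcases hI.level_communicate hE hln hj hj' hc hg hi hk with h | ⟨h, -⟩
    · exact h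
    · exact absurd ⟨_, h⟩ (hatt i)
  · intro i hi j'
    rw [Setup.block_communicate]
    exact hI.mal_free_play hE hi j'
  · intro i _ r hr
    exact mal_rec_communicate (hatt i) hr
  · intro hl i hi k hk
    have hki := hI.has_arm hl i hi k hk
    -- The attack arm is not sticky, as sticky arms of the right half have index at least `n / 2`;
    -- being played most, it survives the update.
    refine Setup.mem_active_communicate_of_mostPlayed E hki (fun h => ?_) fun k' hk' hne => ?_
    · have := hE.le_of_mem_init i (by omega) k (Finset.mem_union_left _ h)
      omega
    · exact phasePulls_lt hE i hl hln (by omega) (card_active_le hE i (s i))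
        (hI.level_le i (by omega)) hki hk (s i).pulls hk' hne
  · intro i h hi hh j' hb
    rw [Setup.block_communicate]
    exact hI.next_free_play hE hln hj hi hh hb
  · intro i h hi hh r hr
    obtain ⟨hci, rfl⟩ := contact_of_lastRec hr
    rcases Nat.eq_zero_or_pos l with hl | hl
    · have := hg.early hl i (by omega) (by omega)
      rw [hci] at this
      simp at this
    · refine ⟨hl, ?_⟩
      have hb := hI.best_play hE hln hj hl (Or.inl hh) (k := ⟨n / 2 - l, by omega⟩)
        (Nat.sub_add_cancel hln.le)
      change (E.best (j + 1) h (E.playPhase (j + 1) h (s h))).val + l = n / 2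
      rw [hb]
      exact Nat.sub_add_cancel hln.le
  · intro _ h
    omega
  · intro hl hjl i h hi hh
    have hci := hg.left hl (by omega) i h hi hh
    refine ⟨E.best (j + 1) h (E.play (j + 1) s h), ?_, ?_⟩
    · rw [Setup.lastRec_communicate, hci]
      rfl
    · exact (hI.contact_inl hE hln hj hj' hc hg (by omega) hci).2 (by omega)
  · intro hl hjl i h hi hh j' hjj hjb
    rw [Setup.block_communicate]
    exact hI.left_blocked hE hln hj hl (by omega) hi hh (by omega) hjb

include hE hI hln hj hj' hc hg in
-- The attack moves the front one step to the right: the former front was not a target, so it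
-- becomes a left neighbor that knows only worse arms.
theorem StageInv.succ_stage (hln' : l + 1 < n / 2) (heq : j + 1 = badPhase (l + 1)) :
    StageInv E (l + 1) (j + 1)
    (E.communicate (badStrategy E) (j + 1) (E.play (j + 1) s) c) := by
  have hattack : ∀ i : Fin n, (i.val = n / 2 + l + 1 ∨ i.val = n / 2 + l + 2) →
      IsAttack n (j + 1) i (l + 1) := fun i hi => ⟨by omega, by omega, heq, by omega⟩
  have hlevel : ∀ i : Fin n, n / 2 + (l + 1) ≤ i.val → ∀ k ∈ E.active i
      (E.communicate (badStrategy E) (j + 1) (E.play (j + 1) s) c i),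
      n / 2 ≤ k.val + (l + 1) := by
    intro i hi k hk
    rcases hI.level_communicate hE hln hj hj' hc hg (by omega) hk with h | ⟨-, h⟩ <;> omega
  have harm : ∀ i : Fin n, (i.val = n / 2 + l + 1 ∨ i.val = n / 2 + l + 2) →
      ∀ k : Fin n, k.val + (l + 1) = n / 2 → k ∈ E.active i
        (E.communicate (badStrategy E) (j + 1) (E.play (j + 1) s) c i) := by
    intro i hi k hk
    have h1 := Setup.recommend_mem_active_communicate E (mal := badStrategy E) (j := j + 1)
      (s := (E.play (j + 1) s)) (hg.attack heq i hi)
    have h2 : (E.recommend (badStrategy E) (j + 1) (E.play (j + 1) s) i (Sum.inr 0)).val + (l + 1) =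
        n / 2 :=
      badStrategy_of_isAttack E 0 (j + 1) (E.play (j + 1) s) i (hattack i hi)
    rwa [Fin.ext (by omega : k.val =
      (E.recommend (badStrategy E) (j + 1) (E.play (j + 1) s) i (Sum.inr 0)).val)]
  refine ⟨?_, hlevel, ?_, ?_, ?_, ?_, ?_, ?_, ?_, ?_⟩
  · intro i v j' h
    rw [Setup.block_communicate] at h
    exact hI.block_play_le hE h
  · intro i hi j'
    rw [Setup.block_communicate]
    exact hI.mal_free_play hE (by omega) j'
  · intro i hi r hr
    by_cases hatt : ∃ l', IsAttack n (j + 1) i l'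
    · obtain ⟨l', hl'⟩ := hatt
      obtain rfl := hl'.eq_succ (l := l) (by omega) hj'
      obtain ⟨hci, rfl⟩ := contact_of_lastRec hr
      have h2 : (E.recommend (badStrategy E) (j + 1) (E.play (j + 1) s) i (Sum.inr 0)).val + (l + 1) =
        n / 2 := badStrategy_of_isAttack E 0 (j + 1) (E.play (j + 1) s) i hl'
      -- The arm sent in the attack is the best active one for its recipient, so even this
      -- recommendation does not get the malicious agent blocked.
      exact best_eq hE i (by omega) hln' (by omega) (hlevel i hi)
        (harm i (by have := hl'.2.2.2; omega) _ h2) h2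
    · exact mal_rec_communicate hatt hr
  · intro _ i hi k hk
    exact harm i (by omega) k hk
  · intro i h hi hh j' hb hmem
    rw [Setup.block_communicate] at hmem
    have h1 := hI.block_play_le hE hmem
    have h2 := sq_badPhase_lt (l := l + 1)
    rw [heq] at h1
    omega
  -- The next front has just contacted the malicious agent, so the claim about its left neighbor is
  -- vacuous.
  · intro i h hi hh r hr
    have := (lastRec_of_contact (hg.attack heq i (by omega)) hr).1
    simp at this
  · intro _ _ i h hi hh
    refine ⟨fun j' hb => ?_, fun r hr => ?_, fun k hk => ?_⟩
    · rw [Setup.block_communicate]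
      exact hI.next_free_play hE hln hj (by omega) (by omega) hb
    · have := (lastRec_of_contact (hg.attack heq i (by omega)) hr).1
      simp at this
    · rcases hI.level_communicate hE hln hj hj' hc hg (by omega) hk with h | ⟨h, -⟩
      · omega
      · have := h.2.2.2
        omega
  · intro _ h
    omega
  · intro _ h
    omega

end Step

end Invariant

/-! ### Probability that the attacks succeed -/

section Probability

variable {n : ℕ} {E : Setup n 1 n} (hE : IsBadInstance E)

/-- The last agent pulls suboptimal arms only, up to time `t₀`. -/
def NeverBest (t₀ : ℕ) : Set (State n 1 n) :=
  {s | ∀ t, 1 ≤ t → t ≤ t₀ → ∀ i : Fin n, i.val + 1 = n → ((s i).pulls t).val ≠ 0}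

/-- The attacks worked so far, and the last agent pulled suboptimal arms only. -/
def AttackEvent (E : Setup n 1 n) (l j : ℕ) : Set (State n 1 n) :=
  {s | StageInv E l j s} ∩ NeverBest (j ^ 2)

include hE in
theorem pulls_communicate_of_le (mal : Strategy n 1 n) {j : ℕ} {s : State n 1 n}
    {c : Fin n → Option (Fin n ⊕ Fin 1)} {i : Fin n} {t : ℕ} (ht : t ≤ j ^ 2) :
    (E.communicate mal (j + 1) (E.play (j + 1) s) c i).pulls t = (s i).pulls t := by
  rw [Setup.pulls_communicate]
  exact runPhase_of_le hE i _ _ ht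

include hE in
theorem isUCBPull_communicate (mal : Strategy n 1 n) {j : ℕ} {s : State n 1 n}
    {c : Fin n → Option (Fin n ⊕ Fin 1)} {i : Fin n} {t : ℕ} (ht : j ^ 2 < t)
    (ht' : t ≤ (j + 1) ^ 2) : E.IsUCBPull (E.active i (s i))
      (E.communicate mal (j + 1) (E.play (j + 1) s) c i).pulls t := by
  rw [Setup.pulls_communicate]
  exact isUCBPull_runPhase hE i (E.active_nonempty _ _) _ ht ht'

include hE in
-- The last agent has index `n - 1 ≥ n / 2 + l`, so its active arms have index at least `n / 2 - l >
-- 0`.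
theorem neverBest_communicate (mal : Strategy n 1 n) (hn : n = 2 * (n / 2)) {l j : ℕ}
    (hln : l < n / 2) {s : State n 1 n} (hs : s ∈ AttackEvent E l j)
    (c : Fin n → Option (Fin n ⊕ Fin 1)) :
    E.communicate mal (j + 1) (E.play (j + 1) s) c ∈ NeverBest ((j + 1) ^ 2) := by
  intro t ht1 ht i hi
  rcases Nat.lt_or_ge (j ^ 2) t with h | h
  · have := hs.1.level_le i (by omega) _ (isUCBPull_communicate hE mal (c := c) h ht).1
    omega
  · rw [pulls_communicate_of_le hE mal h]
    exact hs.2 t ht1 h i hi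

/-- The number of contacts at the end of phase `j + 1` on which the attack relies. -/
def numForced (l j : ℕ) : ℕ :=
  if l = 0 then 3 else if j = badPhase l then 1 else if j + 1 = badPhase (l + 1) then 2 else 0

theorem card_filter_val_le (A : Finset ℕ) :
    (Finset.univ.filter fun i : Fin n => i.val ∈ A).card ≤ A.card :=
  Finset.card_le_card_of_injOn Fin.val (fun _ hi => (Finset.mem_filter.1 hi).2)
    Fin.val_injective.injOn

include hE in
-- The forced agents are given by natural numbers because some may exceed `n - 1` in the final
-- stages; fewer forced agents only improve the bound.
theorem law_mul_le_of_forced (mal : Strategy n 1 n) {l j : ℕ} {G G' : Set (State n 1 n)}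
    (A : Finset ℕ) (r : Fin n → Fin n ⊕ Fin 1)
    (hr : ∀ s ∈ G, ∀ i : Fin n, i.val ∈ A →
      some (r i) ∈ E.contacts (j + 1) i (E.play (j + 1) s i))
    (hgood : ∀ c : Fin n → Option (Fin n ⊕ Fin 1), (∀ i, i.val ∈ A → c i = some (r i)) →
      GoodContacts l j c)
    (hG : ∀ s ∈ G, ∀ c : Fin n → Option (Fin n ⊕ Fin 1),
      (∀ i, c i ∈ E.contacts (j + 1) i (E.play (j + 1) s i)) → GoodContacts l j c →
      E.communicate mal (j + 1) (E.play (j + 1) s) c ∈ G') :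
    (E.law mal j).toOuterMeasure G * ((3 : ℝ≥0∞) ^ A.card)⁻¹ ≤
      (E.law mal (j + 1)).toOuterMeasure G' := by
  set F := Finset.univ.filter fun i : Fin n => i.val ∈ A with hF
  have hmem : ∀ i, i ∈ F ↔ i.val ∈ A := fun i => by simp [hF]
  have h1 := E.law_mul_le_law_succ mal j (G := G) (G' := G') F r (d := 3)
    (fun s _ i _ => card_contacts_le E hE.G_eq _ _ _)
    (fun s hs i hi => hr s hs i ((hmem i).1 hi))
    (fun s hs c hc hci => hG s hs c hc (hgood c fun i hi => hci i ((hmem i).2 hi)))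
  refine le_trans ?_ h1
  have h3 : (1 : ℝ≥0∞) ≤ ((3 : ℕ) : ℝ≥0∞) := by norm_num
  gcongr
  · norm_num
  · exact card_filter_val_le A

include hE in
-- Each prescribed contact is possible: the malicious agent is never blocked from the front on, and
-- the left neighbor is not blocked by the new front right after an attack, by `StageInv.fresh`.
theorem attackEvent_step {l j : ℕ} {G' : Set (State n 1 n)}
    (hG : ∀ s ∈ AttackEvent E l j, ∀ c : Fin n → Option (Fin n ⊕ Fin 1),
      (∀ i, c i ∈ E.contacts (j + 1) i (E.play (j + 1) s i)) → GoodContacts l j c →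
      E.communicate (badStrategy E) (j + 1) (E.play (j + 1) s) c ∈ G') :
    (E.law (badStrategy E) j).toOuterMeasure (AttackEvent E l j) *
      ((3 : ℝ≥0∞) ^ numForced l j)⁻¹ ≤ (E.law (badStrategy E) (j + 1)).toOuterMeasure G' := by
  have hmal : ∀ s ∈ AttackEvent E l j, ∀ i : Fin n, n / 2 + l ≤ i.val →
      some (Sum.inr 0) ∈ E.contacts (j + 1) i (E.play (j + 1) s i) := by
    intro s hs i hi
    rw [Setup.some_mem_contacts, hE.G_eq]
    exact ⟨badGraph_adj_inr, hs.1.mal_free_play hE hi _⟩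
  unfold numForced
  split_ifs with h0 h1 h2
  · have := law_mul_le_of_forced hE (badStrategy E) (l := l) (j := j) (G := AttackEvent E l j)
      {n / 2, n / 2 + 1, n / 2 + 2} (fun _ => Sum.inr 0)
      (fun s hs i hi => hmal s hs i (by
        simp only [Finset.mem_insert, Finset.mem_singleton] at hi; omega))
      (fun c hc => ⟨fun _ i hi hi' => hc i (by
        simp only [Finset.mem_insert, Finset.mem_singleton]; omega), fun _ i hi => hc i (by
        simp only [Finset.mem_insert, Finset.mem_singleton]; omega), fun _ => by omega⟩) hG
    rwa [Finset.card_eq_three.2 ⟨n / 2, n / 2 + 1, n / 2 + 2, by simp, by simp, by simp, rfl⟩]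
      at this
  · have hlt := badPhase_add_lt l
    have := law_mul_le_of_forced hE (badStrategy E) (l := l) (j := j) (G := AttackEvent E l j)
      {n / 2 + l} (fun i => Sum.inl ⟨i.val - 1, by omega⟩)
      (fun s hs i hi => by
        rw [Finset.mem_singleton] at hi
        have hh : i.val - 1 + 1 = n / 2 + l := by omega
        obtain ⟨hb, hr, -⟩ := hs.1.fresh (by omega) h1 i ⟨i.val - 1, by omega⟩ hi hh
        rw [Setup.some_mem_contacts, hE.G_eq, badGraph_adj_inl]
        refine ⟨Or.inr (by simp only; omega), fun hmem => ?_⟩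
        rcases (E.mem_block_play hE.η_eq).1 hmem with hmem | ⟨r, hr', -⟩
        · exact hb _ (by omega) hmem
        · exact hr r hr')
      (fun c hc => ⟨fun h => absurd h h0, fun h => by omega, fun _ _ i h hi hh => by
        rw [hc i (by rw [hi]; exact Finset.mem_singleton_self _)]
        exact congrArg _ (congrArg _ (Fin.ext (by simp only; omega)))⟩) hG
    simpa using this
  · have := law_mul_le_of_forced hE (badStrategy E) (l := l) (j := j) (G := AttackEvent E l j)
      {n / 2 + l + 1, n / 2 + l + 2} (fun _ => Sum.inr 0)
      (fun s hs i hi => hmal s hs i (by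
        simp only [Finset.mem_insert, Finset.mem_singleton] at hi; omega))
      (fun c hc => ⟨fun h => absurd h h0, fun _ i hi => hc i (by
        simp only [Finset.mem_insert, Finset.mem_singleton]; omega), fun _ h => absurd h h1⟩) hG
    rwa [Finset.card_pair (by simp)] at this
  · exact law_mul_le_of_forced hE (badStrategy E) (l := l) (j := j) (G := AttackEvent E l j)
      ∅ (fun _ => Sum.inr 0) (by simp)
      (fun c _ => ⟨fun h => absurd h h0, fun h => absurd h h2, fun _ h => absurd h h1⟩) hG

include hE in
theorem law_attackEvent_succ (hn : n = 2 * (n / 2)) {l j : ℕ} (hln : l < n / 2)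
    (hj : badPhase l ≤ j) (hj' : j + 1 < badPhase (l + 1)) :
    (E.law (badStrategy E) j).toOuterMeasure (AttackEvent E l j) *
      ((3 : ℝ≥0∞) ^ numForced l j)⁻¹ ≤
    (E.law (badStrategy E) (j + 1)).toOuterMeasure (AttackEvent E l (j + 1)) :=
  attackEvent_step hE fun _ hs c hc hg =>
    ⟨hs.1.succ hE hln hj hj'.le hc hg hj', neverBest_communicate hE _ hn hln hs c⟩

include hE in
theorem law_attackEvent_succ_stage (hn : n = 2 * (n / 2)) {l j : ℕ} (hln : l + 1 < n / 2)
    (hj : badPhase l ≤ j) (hj' : j + 1 = badPhase (l + 1)) :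
    (E.law (badStrategy E) j).toOuterMeasure (AttackEvent E l j) *
      ((3 : ℝ≥0∞) ^ numForced l j)⁻¹ ≤
    (E.law (badStrategy E) (j + 1)).toOuterMeasure (AttackEvent E (l + 1) (j + 1)) :=
  attackEvent_step hE fun _ hs c hc hg =>
    ⟨hs.1.succ_stage hE (by omega) hj hj'.le hc hg hln hj',
      neverBest_communicate hE _ hn (by omega) hs c⟩

theorem inv_pow_three_add (a b : ℕ) :
    ((3 : ℝ≥0∞) ^ (a + b))⁻¹ = ((3 : ℝ≥0∞) ^ a)⁻¹ * ((3 : ℝ≥0∞) ^ b)⁻¹ := by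
  rw [pow_add, ENNReal.mul_inv (Or.inl (by simp)) (Or.inl (by simp))]

include hE in
theorem le_law_attackEvent_zero (hn : n = 2 * (n / 2)) (hn0 : 0 < n / 2) {j : ℕ}
    (hj : j < badPhase 1) : ((3 : ℝ≥0∞) ^ (3 * j))⁻¹ ≤
      (E.law (badStrategy E) j).toOuterMeasure (AttackEvent E 0 j) := by
  induction j with
  | zero =>
    have : E.initState ∈ AttackEvent E 0 0 :=
      ⟨stageInv_initState hE, fun t ht1 ht => by omega⟩
    simp [Setup.law, PMF.toOuterMeasure_pure_apply, this]
  | succ j ih =>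
    have h1 := law_attackEvent_succ hE hn hn0 (Nat.zero_le j) hj
    refine le_trans ?_ h1
    rw [mul_add, inv_pow_three_add]
    exact mul_le_mul_left (ih (by omega)) _

include hE in
-- Before the closing attack, a stage relies on a single contact: that of the front with its left
-- neighbor.
theorem le_law_attackEvent_of_le (hn : n = 2 * (n / 2)) {l : ℕ} (hl : 1 ≤ l) (hln : l < n / 2)
    {e : ℕ} (he : ((3 : ℝ≥0∞) ^ e)⁻¹ ≤ (E.law (badStrategy E) (badPhase l)).toOuterMeasure
      (AttackEvent E l (badPhase l))) {j : ℕ} (hj : badPhase l ≤ j)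
    (hj' : j < badPhase (l + 1)) :
    ((3 : ℝ≥0∞) ^ (e + if j = badPhase l then 0 else 1))⁻¹ ≤
      (E.law (badStrategy E) j).toOuterMeasure (AttackEvent E l j) := by
  induction j, hj using Nat.le_induction with
  | base => simpa using he
  | succ j hj ih =>
    refine le_trans ?_ (law_attackEvent_succ hE hn hln hj hj')
    refine le_trans (le_of_eq ?_) (mul_le_mul_left (ih (by omega)) _)
    have hc : (e + if j = badPhase l then 0 else 1) + numForced l j =
        e + if j + 1 = badPhase l then 0 else 1 := by
      unfold numForced
      split_ifs <;> omega
    rw [← inv_pow_three_add, hc]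

include hE in
theorem le_law_attackEvent_badPhase (hn : n = 2 * (n / 2)) {l : ℕ} (hln : l + 1 < n / 2) :
    ((3 : ℝ≥0∞) ^ (768 + 3 * l))⁻¹ ≤ (E.law (badStrategy E) (badPhase (l + 1))).toOuterMeasure
      (AttackEvent E (l + 1) (badPhase (l + 1))) := by
  induction l with
  | zero =>
    -- The initial stage costs 3 · 255 contacts, and the step containing the first attack 3 more:
    -- 768 in all.
    have h0 := le_law_attackEvent_zero hE hn (by omega) (j := 255) (by simp [badPhase])
    refine le_trans ?_ (law_attackEvent_succ_stage hE hn (l := 0) (j := 255) hln (Nat.zero_le _)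
      (by simp [badPhase]))
    refine le_trans (le_of_eq ?_) (mul_le_mul_left h0 _)
    rw [← inv_pow_three_add]
    rfl
  | succ l ih =>
    have hlt := badPhase_add_lt (l + 1)
    have h0 := le_law_attackEvent_of_le hE hn (by omega) (by omega) (ih (by omega))
      (j := badPhase (l + 1 + 1) - 1) (by omega) (by omega)
    have h1 := law_attackEvent_succ_stage hE hn (l := l + 1) (j := badPhase (l + 1 + 1) - 1) hln
      (by omega) (by omega)
    rw [Nat.sub_add_cancel (by omega)] at h1
    refine le_trans ?_ h1
    refine le_trans (le_of_eq ?_) (mul_le_mul_left h0 _)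
    rw [← inv_pow_three_add, numForced, if_neg (by omega), if_neg (by omega), if_neg (by omega),
      if_pos (by omega)]
    congr 2

include hE in
theorem le_law_attackEvent (hn : n = 2 * (n / 2)) {l j : ℕ} (hln : l < n / 2)
    (hj : badPhase l ≤ j) (hj' : j < badPhase (l + 1)) :
    ((3 : ℝ≥0∞) ^ (768 + 3 * l))⁻¹ ≤
      (E.law (badStrategy E) j).toOuterMeasure (AttackEvent E l j) := by
  rcases l with _ | l
  · refine le_trans ?_ (le_law_attackEvent_zero hE hn hln hj')
    have : j < 256 := by simpa [badPhase] using hj'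
    gcongr
    · norm_num
    · omega
  · refine le_trans ?_ (le_law_attackEvent_of_le hE hn (by omega) hln
      (le_law_attackEvent_badPhase hE hn hln) hj hj')
    refine ENNReal.inv_le_inv.2 (pow_le_pow_right₀ (by norm_num) ?_)
    split_ifs <;> omega

include hE in
-- The arms of phase `j + 1` are fixed by the active sets after phase `j`, and later phases do not
-- rewrite past pulls; neither extension costs probability.
theorem le_law_neverBest (hn : n = 2 * (n / 2)) {l j T : ℕ} (hln : l < n / 2)
    (hj : badPhase l ≤ j) (hj' : j < badPhase (l + 1)) (hT : j + 1 ≤ T) :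
    ((3 : ℝ≥0∞) ^ (768 + 3 * l))⁻¹ ≤
      (E.law (badStrategy E) T).toOuterMeasure (NeverBest ((j + 1) ^ 2)) := by
  refine (le_law_attackEvent hE hn hln hj hj').trans ?_
  have h1 := E.law_mul_le_law_succ (badStrategy E) j (G := AttackEvent E l j)
    (G' := NeverBest ((j + 1) ^ 2)) ∅ (fun i => Sum.inl i) (d := 0) (by simp) (by simp)
    fun s hs c _ _ => neverBest_communicate hE _ hn hln hs c
  have h2 := E.law_le_law_of_invariant (badStrategy E) (G := fun _ => NeverBest ((j + 1) ^ 2)) hT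
    fun u hu _ s hs c _ t ht1 ht i hi => by
      rw [pulls_communicate_of_le hE _ (ht.trans (Nat.pow_le_pow_left hu 2))]
      exact hs t ht1 ht i hi
  refine le_trans ?_ (h1.trans h2)
  simp

end Probability

/-! ### From probabilities to regret -/

section Regret

variable {n : ℕ} {E : Setup n 1 n} (hE : IsBadInstance E)

theorem Setup.mul_le_regret {m K : ℕ} (E : Setup n m K) (mal : Strategy n m K) {k₁ : Fin K}
    (hk₁ : ∀ k, E.μ k ≤ E.μ k₁) (i : Fin n) (T : ℕ) {x : ℝ} (hx : 0 ≤ x) (G : Set (State n m K))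
    (hG : ∀ s ∈ G, x ≤ ∑ t ∈ Finset.Icc 1 T, (E.μ k₁ - E.μ ((s i).pulls t))) {p : ℝ≥0∞}
    (hp : p ≤ (E.law mal T).toOuterMeasure G) : x * p.toReal ≤ E.regret mal k₁ i T := by
  refine le_trans ?_ (E.mul_law_le_regret mal hk₁ i T G hG)
  refine mul_le_mul_of_nonneg_left (ENNReal.toReal_mono ?_ hp) hx
  rw [← PMF.toMeasure_apply_eq_toOuterMeasure_apply _ (by trivial)]
  exact MeasureTheory.measure_ne_top _ _

include hE

theorem IsBadInstance.μ_le {k₁ : Fin n} (hk₁ : k₁.val = 0) (k : Fin n) : E.μ k ≤ E.μ k₁ := by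
  rw [hE.μ_eq, hE.μ_eq, hk₁, zero_add, badMean_one]
  exact badMean_le_one _ _

/-- As long as the attacks work, the last agent has linear regret. -/
theorem linear_le_regret (hn : n = 2 * (n / 2)) {l j T M : ℕ} (hln : l < n / 2)
    (hj : badPhase l ≤ j) (hj' : j < badPhase (l + 1)) (hT : j + 1 ≤ T) (hMT : M ≤ T)
    (hMj : M ≤ (j + 1) ^ 2) {k₁ i : Fin n} (hk₁ : k₁.val = 0) (hi : i.val + 1 = n) :
    (M : ℝ) / 15 * ((3 : ℝ) ^ (768 + 3 * l))⁻¹ ≤ E.regret (badStrategy E) k₁ i T := by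
  have h := E.mul_le_regret (badStrategy E) (hE.μ_le hk₁) i T (x := (M : ℝ) / 15) (by positivity)
    (NeverBest ((j + 1) ^ 2)) (fun s hs => ?_) (le_law_neverBest hE hn hln hj hj' hT)
  · simpa using h
  · have hsub : Finset.Icc 1 M ⊆ Finset.Icc 1 T := Finset.Icc_subset_Icc_right hMT
    refine le_trans ?_ (Finset.sum_le_sum_of_subset_of_nonneg hsub fun t _ _ =>
      sub_nonneg.2 (hE.μ_le hk₁ _))
    have : ∀ t ∈ Finset.Icc 1 M, (1 / 15 : ℝ) ≤ E.μ k₁ - E.μ ((s i).pulls t) := by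
      intro t ht
      rw [Finset.mem_Icc] at ht
      have hne := hs t ht.1 (ht.2.trans hMj) i hi
      rw [hE.μ_eq, hE.μ_eq, hk₁, zero_add, badMean_one]
      have := badMean_le n (k := ((s i).pulls t).val + 1) (by omega)
      linarith
    have := Finset.card_nsmul_le_sum _ _ _ this
    rw [Nat.card_Icc, nsmul_eq_mul, Nat.add_sub_cancel] at this
    linarith

/-- The sticky arm alone causes logarithmic regret. -/
theorem log_le_regret (hn : n = 2 * (n / 2)) {T M : ℕ} (hM : T ≤ M ^ 2)
    (hMT : M ≤ T) (hM0 : 1 < M) (hT : n * (Real.log T + 1) < (T - M : ℝ)) {k₁ i : Fin n}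
    (hk₁ : k₁.val = 0) (hi : i.val + 1 = n) :
    2 / 9 * Real.log T ≤ E.regret (badStrategy E) k₁ i T := by
  obtain ⟨k, hk⟩ := Finset.card_pos.1 (by rw [hE.card_sticky i]; norm_num : 0 < (E.sticky i).card)
  have hkn : n / 2 ≤ k.val := hE.le_of_mem_init i (by omega) k (Finset.mem_union_left _ hk)
  have hμk : E.μ k = 0 := by rw [hE.μ_eq, badMean_eq_zero (by omega) (by omega)]
  -- A sure event: the sticky arm, of mean 0 since the last agent is in the right half, always
  -- competes under UCB.
  let V : ℕ → Set (State n 1 n) := fun j =>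
    {s | ∀ u, 0 < u → u ≤ j ^ 2 → ∃ S, k ∈ S ∧ E.IsUCBPull S (s i).pulls u}
  have hV : 1 ≤ (E.law (badStrategy E) T).toOuterMeasure (V T) := by
    have h0 : (E.law (badStrategy E) 0).toOuterMeasure (V 0) = 1 := by
      rw [Setup.law, PMF.toOuterMeasure_pure_apply, if_pos]
      intro u hu hu0
      omega
    rw [← h0]
    refine E.law_le_law_of_invariant _ (Nat.zero_le T) fun j _ _ s hs c _ u hu huj => ?_
    rcases Nat.lt_or_ge (j ^ 2) u with h | h
    · exact ⟨_, Finset.mem_union_left _ hk, isUCBPull_communicate hE _ h huj⟩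
    · obtain ⟨S, hkS, hS⟩ := hs u hu h
      exact ⟨S, hkS, hS.congr fun t ht => (pulls_communicate_of_le hE _ (ht.trans h)).symm⟩
  have h := E.mul_le_regret (badStrategy E) (hE.μ_le hk₁) i T (x := 2 / 9 * Real.log T)
    (mul_nonneg (by norm_num) (Real.log_natCast_nonneg T)) (V T) (fun s hs => ?_) hV
  · simpa using h
  · have h1 := E.log_le_numPulls (I := (s i).pulls) (T := T) (k := k)
      (fun u hu huT => hs u hu (huT.trans (Nat.le_self_pow two_ne_zero T))) hE.α_eq
      (fun k' => by rw [hE.μ_eq]; exact badMean_le_one _ _) hμk.ge hM hMT hM0 hT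
    refine h1.trans ?_
    refine le_trans ?_ (Finset.sum_le_sum_of_subset_of_nonneg
      (Finset.filter_subset (fun t => (s i).pulls t = k) _) fun t _ _ =>
        sub_nonneg.2 (hE.μ_le hk₁ _))
    rw [Finset.sum_congr rfl fun t ht => by rw [(Finset.mem_filter.1 ht).2], Finset.sum_const,
      hμk, hE.μ_eq, hk₁, zero_add, badMean_one]
    simp [numPulls]

end Regret

/-! ### Numerical estimates -/

section Asymptotics

theorem exists_badPhase_le {j N : ℕ} (hj : j < badPhase N) :
    ∃ l < N, badPhase l ≤ j ∧ j < badPhase (l + 1) := by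
  induction N with
  | zero => simp [badPhase] at hj
  | succ N ih =>
    rcases Nat.lt_or_ge j (badPhase N) with h | h
    · obtain ⟨l, hl, h⟩ := ih h
      exact ⟨l, by omega, h⟩
    · exact ⟨N, by omega, h, hj⟩

theorem two_pow_le_log {l T : ℕ} (hl : 1 ≤ l) (hT : badPhase l ^ 2 ≤ T) :
    4 * 2 ^ l ≤ Real.log T := by
  have h1 : 2 ^ (2 ^ (l + 3)) ≤ T := by
    refine le_trans ?_ hT
    rw [show l + 3 = (l + 2) + 1 by omega, pow_succ 2 (l + 2), pow_mul]
    exact Nat.pow_le_pow_left (two_pow_le_badPhase hl) 2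
  have h2 : Real.log ((2 : ℝ) ^ (2 ^ (l + 3))) ≤ Real.log T :=
    Real.log_le_log (by positivity) (by exact_mod_cast h1)
  rw [Real.log_pow] at h2
  push_cast at h2
  have h3 := Real.log_two_gt_d9
  have h4 : (2 : ℝ) ^ (l + 3) = 8 * 2 ^ l := by ring
  have h5 : (0 : ℝ) < 2 ^ l := by positivity
  rw [h4] at h2
  nlinarith

/-- With e^(2/3) ≤ 2, e ≤ 4 and 27 ≤ 2^5, the left side is at most 2^(2·2^N + 5N), and N < 2^N. The
right side bounds `badPhase N ^ 2` from below. -/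
theorem exp_exp_le (N : ℕ) : Real.exp (Real.exp (2 * N / 3)) * 27 ^ N ≤ 2 ^ (2 ^ (N + 3)) := by
  have h1 : Real.exp (2 * N / 3) ≤ 2 ^ N := by
    rw [show (2 * N / 3 : ℝ) = N * (2 / 3) by ring, Real.exp_nat_mul]
    have : Real.exp (2 / 3) ≤ 2 := by
      rw [← Real.le_log_iff_exp_le (by norm_num)]
      linarith [Real.log_two_gt_d9]
    gcongr
  have h2 : Real.exp (Real.exp (2 * N / 3)) ≤ 2 ^ (2 * 2 ^ N) := by
    calc Real.exp (Real.exp (2 * N / 3)) ≤ Real.exp (((2 ^ N : ℕ) : ℝ) * 1) := by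
          apply Real.exp_le_exp.2; push_cast; linarith
      _ = Real.exp 1 ^ (2 ^ N) := Real.exp_nat_mul _ _
      _ ≤ 4 ^ (2 ^ N) := by
          gcongr
          linarith [Real.exp_one_lt_d9]
      _ = 2 ^ (2 * 2 ^ N) := by rw [pow_mul]; norm_num
  have h3 : (27 : ℝ) ^ N ≤ 2 ^ (5 * N) := by
    rw [pow_mul]; gcongr; norm_num
  have h4 : N < 2 ^ N := Nat.lt_two_pow_self
  calc Real.exp (Real.exp (2 * N / 3)) * 27 ^ N ≤ 2 ^ (2 * 2 ^ N) * 2 ^ (5 * N) := by gcongr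
    _ = 2 ^ (2 * 2 ^ N + 5 * N) := (pow_add _ _ _).symm
    _ ≤ _ := by
        apply pow_le_pow_right₀ (by norm_num)
        have : 2 ^ (N + 3) = 8 * 2 ^ N := by ring
        omega

/-- In terms of y = T^(1/4) ≥ 16, one has log T ≤ 4y and M ≤ y^2 + 1, so the claim compares y^2 with
y^4. -/
theorem log_sq_lt {T M : ℕ} (hT : 2 ^ 16 ≤ T) (hM : (M - 1) ^ 2 ≤ T) :
    Real.log T * (Real.log T + 1) < (T - M : ℝ) := by
  set y : ℝ := Real.sqrt (Real.sqrt T) with hy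
  have hTr : (16 : ℝ) ^ 4 ≤ T := by
    have : ((2 ^ 16 : ℕ) : ℝ) ≤ T := by exact_mod_cast hT
    norm_num at this ⊢
    exact this
  have hy2 : y ^ 2 = Real.sqrt T := Real.sq_sqrt (Real.sqrt_nonneg _)
  have hy4 : y ^ 4 = T := by
    rw [show y ^ 4 = (y ^ 2) ^ 2 by ring, hy2, Real.sq_sqrt (Nat.cast_nonneg _)]
  have hy16 : 16 ≤ y := by
    by_contra h
    push Not at h
    have := pow_lt_pow_left₀ h (Real.sqrt_nonneg _) (four_ne_zero)
    rw [hy4] at this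
    linarith
  have hlog : Real.log T ≤ 4 * y := by
    rw [← hy4, Real.log_pow]
    have := Real.log_le_sub_one_of_pos (x := y) (by linarith)
    push_cast
    linarith
  have hlog0 : 0 ≤ Real.log T := Real.log_natCast_nonneg _
  have hMle : (M : ℝ) ≤ y ^ 2 + 1 := by
    have h1 : ((M - 1 : ℕ) : ℝ) ≤ y ^ 2 := by
      rw [hy2]
      exact Real.le_sqrt_of_sq_le (by exact_mod_cast hM)
    have h2 : (M : ℝ) ≤ ((M - 1 : ℕ) : ℝ) + 1 := by exact_mod_cast (by omega : M ≤ M - 1 + 1)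
    linarith
  have h1 : Real.log T * (Real.log T + 1) ≤ 4 * y * (4 * y + 1) := by gcongr
  have h2 : 256 * y ^ 2 ≤ y ^ 4 := by nlinarith [sq_nonneg y]
  nlinarith

end Asymptotics

/-! ### The two regimes of the horizon -/

section Bounds

variable {n : ℕ} {E : Setup n 1 n} (hE : IsBadInstance E) (hn : n = 2 * (n / 2))

include hE hn

theorem div_log_pow_le_regret {T : ℕ} (hT : 2 ≤ T) (hTn : T ≤ badPhase (n / 2) ^ 2) {k₁ i : Fin n}
    (hk₁ : k₁.val = 0) (hi : i.val + 1 = n) :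
    ((3 : ℝ) ^ 768)⁻¹ / 1920 * (T / Real.log T ^ 7) ≤ E.regret (badStrategy E) k₁ i T := by
  -- Time `T` lies in phase `j + 1`.
  obtain ⟨j, hj1, hj2⟩ : ∃ j, j ^ 2 < T ∧ T ≤ (j + 1) ^ 2 := by
    have h1 := Nat.sqrt_le' (T - 1)
    have h2 := Nat.lt_succ_sqrt' (T - 1)
    rw [Nat.succ_eq_add_one] at h2
    exact ⟨Nat.sqrt (T - 1), by omega, by omega⟩
  have hjn : j < badPhase (n / 2) := by
    by_contra h
    have := Nat.pow_le_pow_left (not_lt.1 h) 2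
    omega
  obtain ⟨l, hln, hlj, hjl⟩ := exists_badPhase_le hjn
  have hjT : j + 1 ≤ T := by nlinarith
  refine le_trans ?_ (linear_le_regret hE hn hln hlj hjl hjT le_rfl hj2 hk₁ hi)
  -- The division by 2 is only needed in stage 0, where `T` may be 2.
  have hlog : 2 ^ l / 2 ≤ Real.log T := by
    rcases Nat.eq_zero_or_pos l with rfl | hl
    · have : Real.log 2 ≤ Real.log T := Real.log_le_log (by norm_num) (by exact_mod_cast hT)
      have := Real.log_two_gt_d9
      norm_num
      linarith
    · have := two_pow_le_log hl ((Nat.pow_le_pow_left hlj 2).trans hj1.le)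
      have h0 : (0 : ℝ) < 2 ^ l := by positivity
      linarith
  -- Here 27 ≤ 2^7 yields the exponent 7; the 128 = 2^7, times 15 from the gap, makes up 1920.
  have hlog7 : 27 ^ l / 128 ≤ Real.log T ^ 7 := by
    calc (27 : ℝ) ^ l / 128 ≤ (2 ^ l / 2) ^ 7 := by
          rw [div_pow, ← pow_mul, mul_comm l 7, pow_mul]
          norm_num
          gcongr
          norm_num
      _ ≤ _ := by gcongr
  have hpos : (0 : ℝ) < 27 ^ l / 128 := by positivity
  rw [pow_add, pow_mul, mul_inv]
  norm_num only [show (3 : ℝ) ^ 3 = 27 by norm_num]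
  calc ((3 : ℝ) ^ 768)⁻¹ / 1920 * (T / Real.log T ^ 7)
      ≤ ((3 : ℝ) ^ 768)⁻¹ / 1920 * (T / (27 ^ l / 128)) := by gcongr
    _ = _ := by field_simp; norm_num

theorem log_add_exp_le_regret (hn0 : 0 < n / 2) {T : ℕ} (hT : badPhase (n / 2) ^ 2 < T)
    {k₁ i : Fin n} (hk₁ : k₁.val = 0) (hi : i.val + 1 = n) :
    ((3 : ℝ) ^ 768)⁻¹ / 1920 * (Real.log T + Real.exp (Real.exp ((n : ℝ) / 3))) ≤
      E.regret (badStrategy E) k₁ i T := by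
  set N := n / 2 with hN
  have hJ : 256 ≤ badPhase N := by
    have := badPhase_strictMono.monotone (show 1 ≤ N from hn0)
    simpa [badPhase] using this
  have hT16 : 2 ^ 16 ≤ T := by nlinarith
  -- The last phase of the last usable stage: the linear regret extends up to time `badPhase N ^ 2`.
  have hlin := linear_le_regret hE hn (l := N - 1) (j := badPhase N - 1) (T := T)
    (M := badPhase N ^ 2) (by omega)
    (by
      have := badPhase_strictMono (show N - 1 < N by omega)
      omega)
    (by rw [Nat.sub_add_cancel hn0]; omega)
    (by nlinarith [Nat.sub_add_cancel (show 1 ≤ badPhase N by omega)])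
    hT.le (by rw [Nat.sub_add_cancel (by omega)]) hk₁ hi
  have hexp : Real.exp (Real.exp ((n : ℝ) / 3)) * 27 ^ N ≤ ((badPhase N ^ 2 : ℕ) : ℝ) := by
    have hnr : (n : ℝ) = 2 * N := by exact_mod_cast hn
    rw [hnr]
    refine (exp_exp_le N).trans ?_
    have : 2 ^ (2 ^ (N + 3)) ≤ badPhase N ^ 2 := by
      rw [show N + 3 = (N + 2) + 1 by omega, pow_succ 2 (N + 2), pow_mul]
      exact Nat.pow_le_pow_left (two_pow_le_badPhase hn0) 2
    exact_mod_cast this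
  have h1 : ((3 : ℝ) ^ 768)⁻¹ / 15 * Real.exp (Real.exp ((n : ℝ) / 3)) ≤
      E.regret (badStrategy E) k₁ i T := by
    refine le_trans ?_ hlin
    have hle : ((27 : ℝ) ^ N)⁻¹ * ((3 : ℝ) ^ 768)⁻¹ ≤ ((3 : ℝ) ^ (768 + 3 * (N - 1)))⁻¹ := by
      rw [← mul_inv, mul_comm, show (27 : ℝ) = 3 ^ 3 by norm_num, ← pow_mul, ← pow_add]
      gcongr
      · norm_num
      · omega
    calc ((3 : ℝ) ^ 768)⁻¹ / 15 * Real.exp (Real.exp ((n : ℝ) / 3))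
        = (Real.exp (Real.exp ((n : ℝ) / 3)) * 27 ^ N) / 15 *
            (((27 : ℝ) ^ N)⁻¹ * ((3 : ℝ) ^ 768)⁻¹) := by field_simp
      _ ≤ _ := by gcongr
  have h2 : 2 / 9 * Real.log T ≤ E.regret (badStrategy E) k₁ i T := by
    have hs1 := Nat.sqrt_le' T
    have hs2 := Nat.lt_succ_sqrt' T
    rw [Nat.succ_eq_add_one] at hs2
    have hs3 : 256 ≤ Nat.sqrt T := Nat.le_sqrt'.2 (by omega)
    -- Rounding up makes `T ≤ M ^ 2`. The number of arms is at most `log T`, since `T` is beyond the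
    -- last attack phase squared.
    refine log_le_regret hE hn (M := Nat.sqrt T + 1) hs2.le (by nlinarith) (by omega) ?_ hk₁ hi
    refine lt_of_le_of_lt ?_ (log_sq_lt hT16 (M := Nat.sqrt T + 1) (by simpa using hs1))
    have hlog := two_pow_le_log hn0 hT.le
    have hnl : (n : ℝ) ≤ Real.log T := by
      have h3 : N < 2 ^ N := Nat.lt_two_pow_self
      have h4 : (n : ℝ) ≤ 4 * 2 ^ N := by exact_mod_cast (by omega : n ≤ 4 * 2 ^ N)
      linarith
    have := Real.log_natCast_nonneg T
    gcongr
  have hc : ((3 : ℝ) ^ 768)⁻¹ ≤ 1 := inv_le_one_of_one_le₀ (one_le_pow₀ (by norm_num))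
  have hc0 : 0 < ((3 : ℝ) ^ 768)⁻¹ := by positivity
  generalize ((3 : ℝ) ^ 768)⁻¹ = c at *
  have h3 : 0 ≤ Real.log T := Real.log_natCast_nonneg T
  have h4 : 0 ≤ Real.exp (Real.exp ((n : ℝ) / 3)) := (Real.exp_pos _).le
  have h5 : c * Real.log T ≤ Real.log T := mul_le_of_le_one_left h3 hc
  have h6 : 0 ≤ c * Real.exp (Real.exp ((n : ℝ) / 3)) := mul_nonneg hc0.le h4
  linarith

end Bounds

end RobustBandit

theorem theorem1 :
    ∃ C : ℝ, 0 < C ∧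
      ∀ (n : ℕ) (hn : 4 ≤ n), Even n →
      ∀ (sticky : Fin n → Finset (Fin n)) (U₁ L₁ : Fin n → Fin n),
        RobustBandit.BadInit n sticky U₁ L₁ →
      ∀ (tieUCB tieBest tieKeep : Fin n → ℕ → RobustBandit.TieBreak n) (T : ℕ), 2 ≤ T →
        C * min (Real.log T + Real.exp (Real.exp ((n : ℝ) / 3))) ((T : ℝ) / Real.log T ^ 7) ≤
          (RobustBandit.badSetup n sticky U₁ L₁ tieUCB tieBest tieKeep).regret
            (RobustBandit.badStrategy
              (RobustBandit.badSetup n sticky U₁ L₁ tieUCB tieBest tieKeep))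
            ⟨0, by omega⟩ ⟨n - 1, by omega⟩ T := by
  refine ⟨((3 : ℝ) ^ 768)⁻¹ / 1920, by positivity, ?_⟩
  intro n hn heven sticky U₁ L₁ hinit tieUCB tieBest tieKeep T hT
  have hE := RobustBandit.isBadInstance_badSetup hinit tieUCB tieBest tieKeep
  have hn2 : n = 2 * (n / 2) := (Nat.two_mul_div_two_of_even heven).symm
  have hlast : (⟨n - 1, by omega⟩ : Fin n).val + 1 = n := Nat.sub_add_cancel (by omega)
  have hc : (0 : ℝ) ≤ ((3 : ℝ) ^ 768)⁻¹ / 1920 := by positivity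
  rcases Nat.lt_or_ge (RobustBandit.badPhase (n / 2) ^ 2) T with h | h
  · exact (mul_le_mul_of_nonneg_left (min_le_left _ _) hc).trans
      (RobustBandit.log_add_exp_le_regret hE hn2 (by omega) h rfl hlast)
  · exact (mul_le_mul_of_nonneg_left (min_le_right _ _) hc).trans
      (RobustBandit.div_log_pow_le_regret hE hn2 hT h rfl hlast)
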